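/- Let $k$ be an algebraically closed field of characteristic zero, $G$ a finite group with trivial center, and $H\subseteq G$ an abelian subgroup with character group $\widehat H=\operatorname{Hom}(H,k^{\times})$. Let $\omega:\widehat H\times\widehat H\to k^{\times}$ be a normalized 2-cocycle, and for $\chi\in\widehat H$ put $e_\chi=\frac1{|H|}\sum_{h\in H}\chi(h^{-1})h$. Let $$J=\sum_{\alpha,\beta\in\widehat H}\omega(\alpha,\beta)\,e_\alpha\otimes e_\beta\in kG\otimes kG$$ be the corresponding twist, and let $A=(kG)^J$ be the twisted Hopf algebra: $A=kG$ as an algebra with the same counit, $\Delta^J(a)=J^{-1}\Delta(a)J$ and $S^J(a)=v^{-1}S(a)v$, where $v=m(S\otimes\mathrm{id})(J)$. Call $\chi\in\widehat H$ $\omega$-regular if $\omega(\chi,\psi)=\omega(\psi,\chi)$ for all $\psi\in\widehat H$, and call $\omega$ non-degenerate if $1$ is the only $\omega$-regular element of $\widehat H$. Call a surjective Hopf algebra map $\pi:A\to B$ normal if it is dual to a normal Hopf subalgebra, that is, if the left adjoint coaction $a\mapsto\sum a_1S(a_3)\otimes a_2$ of $A$ maps $\ker\pi$ into $A\otimes\ker\pi$.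 Let $p$ be the least prime dividing $|G|$, let $F\cong\mathbb Z_p$, and let $\pi:A\to kF$ be a surjective Hopf algebra map. For $\mu\in\widehat F=\operatorname{Hom}(F,k^\times)$, extended linearly to $kF$, let $\mu|_H\in\widehat H$ denote the character $h\mapsto\mu(\pi(h))$. Then $\pi$ is normal if and only if $\mu|_H$ is $\omega$-regular for all $\mu\in\widehat F$. If $\omega$ is non-degenerate, then $\pi$ is normal if and only if $\mu|_H=1$ for all $\mu\in\widehat F$. -/

import Mathlib

open scoped TensorProduct

/-- A twist in a Hopf algebra `A`: an invertible `J ∈ A ⊗ A` with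
`(Δ ⊗ id)(J) (J ⊗ 1) = (id ⊗ Δ)(J) (1 ⊗ J)` and `(ε ⊗ id)(J) = (id ⊗ ε)(J) = 1`. -/
structure HopfTwist (k A : Type*) [CommRing k] [Ring A] [HopfAlgebra k A] where
  /-- The underlying invertible element. -/
  J : (A ⊗[k] A)ˣ
  cocycle :
    Algebra.TensorProduct.assoc k k k A A A
        (Algebra.TensorProduct.map (Bialgebra.comulAlgHom k A) (AlgHom.id k A) (J : A ⊗[k] A) *
          ((J : A ⊗[k] A) ⊗ₜ[k] (1 : A))) =
      Algebra.TensorProduct.map (AlgHom.id k A) (Bialgebra.comulAlgHom k A) (J : A ⊗[k] A) *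
        ((1 : A) ⊗ₜ[k] (J : A ⊗[k] A))
  counit_left :
    Algebra.TensorProduct.lid k A
      (Algebra.TensorProduct.map (Bialgebra.counitAlgHom k A) (AlgHom.id k A) (J : A ⊗[k] A)) = 1
  counit_right :
    Algebra.TensorProduct.rid k k A
      (Algebra.TensorProduct.map (AlgHom.id k A) (Bialgebra.counitAlgHom k A) (J : A ⊗[k] A)) = 1

namespace HopfTwist

variable {k A : Type*} [CommRing k] [Ring A] [HopfAlgebra k A] (T : HopfTwist k A)

/-- The twisted comultiplication `Δ^J(h) = J⁻¹ Δ(h) J`. -/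
noncomputable def comul : A →ₐ[k] A ⊗[k] A :=
  AlgHom.ofLinearMap
    (LinearMap.mulLeft k (↑T.J⁻¹ : A ⊗[k] A) ∘ₗ LinearMap.mulRight k (↑T.J : A ⊗[k] A) ∘ₗ
      Coalgebra.comul)
    (by simp) (fun x y => by simp [mul_assoc])

theorem comul_apply (h : A) :
    T.comul h = (↑T.J⁻¹ : A ⊗[k] A) * Coalgebra.comul (R := k) h * (↑T.J : A ⊗[k] A) := by
  simp [comul, mul_assoc]

theorem map_comul_left (x : A ⊗[k] A) :
    Algebra.TensorProduct.map T.comul (AlgHom.id k A) x =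
      ((↑T.J⁻¹ : A ⊗[k] A) ⊗ₜ[k] (1 : A)) *
        Algebra.TensorProduct.map (Bialgebra.comulAlgHom k A) (AlgHom.id k A) x *
        ((↑T.J : A ⊗[k] A) ⊗ₜ[k] (1 : A)) := by
  induction x with
  | zero => simp
  | tmul a b => simp [comul_apply]
  | add a b ha hb => simp only [map_add, ha, hb, mul_add, add_mul]

theorem map_comul_right (x : A ⊗[k] A) :
    Algebra.TensorProduct.map (AlgHom.id k A) T.comul x =
      ((1 : A) ⊗ₜ[k] (↑T.J⁻¹ : A ⊗[k] A)) *
        Algebra.TensorProduct.map (AlgHom.id k A) (Bialgebra.comulAlgHom k A) x *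
        ((1 : A) ⊗ₜ[k] (↑T.J : A ⊗[k] A)) := by
  induction x with
  | zero => simp
  | tmul a b => simp [comul_apply]
  | add a b ha hb => simp only [map_add, ha, hb, mul_add, add_mul]

theorem coassoc_apply (h : A) :
    Algebra.TensorProduct.assoc k k k A A A
        (Algebra.TensorProduct.map T.comul (AlgHom.id k A) (T.comul h)) =
      Algebra.TensorProduct.map (AlgHom.id k A) T.comul (T.comul h) := by
  rw [map_comul_left, map_comul_right, comul_apply]
  have hco : Algebra.TensorProduct.assoc k k k A A A
      (Algebra.TensorProduct.map (Bialgebra.comulAlgHom k A) (AlgHom.id k A)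
        (Coalgebra.comul (R := k) h)) =
      Algebra.TensorProduct.map (AlgHom.id k A) (Bialgebra.comulAlgHom k A)
        (Coalgebra.comul (R := k) h) := Coalgebra.coassoc_apply (R := k) h
  have hc := T.cocycle
  set P := Algebra.TensorProduct.map (Bialgebra.comulAlgHom k A) (AlgHom.id k A)
  set Q := Algebra.TensorProduct.map (AlgHom.id k A) (Bialgebra.comulAlgHom k A)
  set as := Algebra.TensorProduct.assoc k k k A A A
  have hJ : (↑T.J⁻¹ : A ⊗[k] A) * ↑T.J = 1 := T.J.inv_mul
  have hJ' : (↑T.J : A ⊗[k] A) * ↑T.J⁻¹ = 1 := T.J.mul_inv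
  set J : A ⊗[k] A := ↑T.J
  set K : A ⊗[k] A := ↑T.J⁻¹
  -- the two inverses agree because the elements they invert agree
  have e1 : as ((K ⊗ₜ[k] (1 : A)) * P K) * as (P J * (J ⊗ₜ[k] (1 : A))) = 1 := by
    rw [← map_mul, show (K ⊗ₜ[k] (1 : A)) * P K * (P J * (J ⊗ₜ[k] (1 : A))) =
      (K ⊗ₜ[k] (1 : A)) * (P K * P J) * (J ⊗ₜ[k] (1 : A)) by simp only [mul_assoc], ← map_mul, hJ,
      map_one, mul_one, Algebra.TensorProduct.tmul_mul_tmul, hJ, mul_one]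
    exact map_one _
  have e2 : (Q J * ((1 : A) ⊗ₜ[k] J)) * (((1 : A) ⊗ₜ[k] K) * Q K) = 1 := by
    rw [show (Q J * ((1 : A) ⊗ₜ[k] J)) * (((1 : A) ⊗ₜ[k] K) * Q K) =
      Q J * (((1 : A) ⊗ₜ[k] J) * ((1 : A) ⊗ₜ[k] K)) * Q K by simp only [mul_assoc],
      Algebra.TensorProduct.tmul_mul_tmul, hJ', mul_one, ← Algebra.TensorProduct.one_def,
      mul_one, ← map_mul, hJ', map_one]
  have e3 : as ((K ⊗ₜ[k] (1 : A)) * P K) = ((1 : A) ⊗ₜ[k] K) * Q K :=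
    left_inv_eq_right_inv (hc ▸ e1) e2
  calc as ((K ⊗ₜ[k] (1 : A)) * P (K * Coalgebra.comul (R := k) h * J) * (J ⊗ₜ[k] (1 : A)))
      = as ((K ⊗ₜ[k] (1 : A)) * P K) * as (P (Coalgebra.comul (R := k) h)) *
          as (P J * (J ⊗ₜ[k] (1 : A))) := by simp only [map_mul, mul_assoc]
    _ = _ := by rw [e3, hco, hc]; simp only [map_mul, mul_assoc]

theorem counit_left_apply (h : A) :
    Algebra.TensorProduct.lid k A (Algebra.TensorProduct.map (Bialgebra.counitAlgHom k A)
      (AlgHom.id k A) (T.comul h)) = h := by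
  have hJ := T.counit_left
  have hK : Algebra.TensorProduct.lid k A (Algebra.TensorProduct.map (Bialgebra.counitAlgHom k A)
      (AlgHom.id k A) (↑T.J⁻¹ : A ⊗[k] A)) = 1 := by
    have := congrArg (fun x => Algebra.TensorProduct.lid k A (Algebra.TensorProduct.map
      (Bialgebra.counitAlgHom k A) (AlgHom.id k A) x)) T.J.inv_mul
    simpa only [map_mul, hJ, mul_one, map_one] using this
  have hh : Algebra.TensorProduct.lid k A (Algebra.TensorProduct.map (Bialgebra.counitAlgHom k A)
      (AlgHom.id k A) (Coalgebra.comul (R := k) h)) = h := by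
    have := Coalgebra.rTensor_counit_comul (R := k) h
    have h2 : Algebra.TensorProduct.map (Bialgebra.counitAlgHom k A)
      (AlgHom.id k A) (Coalgebra.comul (R := k) h) = 1 ⊗ₜ[k] h := this
    rw [h2]; simp
  rw [comul_apply]
  simp only [map_mul, hJ, hK, hh, one_mul, mul_one]

theorem counit_right_apply (h : A) :
    Algebra.TensorProduct.rid k k A (Algebra.TensorProduct.map (AlgHom.id k A)
      (Bialgebra.counitAlgHom k A) (T.comul h)) = h := by
  have hJ := T.counit_right
  have hK : Algebra.TensorProduct.rid k k A (Algebra.TensorProduct.map (AlgHom.id k A)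
      (Bialgebra.counitAlgHom k A) (↑T.J⁻¹ : A ⊗[k] A)) = 1 := by
    have := congrArg (fun x => Algebra.TensorProduct.rid k k A (Algebra.TensorProduct.map
      (AlgHom.id k A) (Bialgebra.counitAlgHom k A) x)) T.J.inv_mul
    simpa only [map_mul, hJ, mul_one, map_one] using this
  have hh : Algebra.TensorProduct.rid k k A (Algebra.TensorProduct.map (AlgHom.id k A)
      (Bialgebra.counitAlgHom k A) (Coalgebra.comul (R := k) h)) = h := by
    have := Coalgebra.lTensor_counit_comul (R := k) h
    have h2 : Algebra.TensorProduct.map (AlgHom.id k A) (Bialgebra.counitAlgHom k A)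
      (Coalgebra.comul (R := k) h) = h ⊗ₜ[k] 1 := this
    rw [h2]; simp
  rw [comul_apply]
  simp only [map_mul, hJ, hK, hh, one_mul, mul_one]

/-- The map `x ⊗ y ↦ S(x) y`. -/
noncomputable def leftMul (k A : Type*) [CommRing k] [Ring A] [HopfAlgebra k A] :
    A ⊗[k] A →ₗ[k] A :=
  LinearMap.mul' k A ∘ₗ (HopfAlgebra.antipode k (A := A)).rTensor A

/-- The map `x ⊗ y ↦ x S(y)`. -/
noncomputable def rightMul (k A : Type*) [CommRing k] [Ring A] [HopfAlgebra k A] :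
    A ⊗[k] A →ₗ[k] A :=
  LinearMap.mul' k A ∘ₗ (HopfAlgebra.antipode k (A := A)).lTensor A

/-- The element `v = m (S ⊗ id)(J)`. -/
noncomputable def v : A := leftMul k A (↑T.J : A ⊗[k] A)

/-- The element `m (id ⊗ S)(J⁻¹)`, which is the inverse of `v`. -/
noncomputable def vInv : A := rightMul k A (↑T.J⁻¹ : A ⊗[k] A)

theorem leftMul_mul_tmul (x : A ⊗[k] A) (a b : A) :
    leftMul k A (x * (a ⊗ₜ[k] b)) = HopfAlgebra.antipode k a * leftMul k A x * b := by
  induction x with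
  | zero => simp
  | tmul c d => simp [leftMul, HopfAlgebra.antipode_mul_antidistrib, mul_assoc]
  | add c d hc hd => simp only [map_add, hc, hd, mul_add, add_mul]

theorem rightMul_tmul_mul (x : A ⊗[k] A) (a b : A) :
    rightMul k A ((a ⊗ₜ[k] b) * x) = a * rightMul k A x * HopfAlgebra.antipode k b := by
  induction x with
  | zero => simp
  | tmul c d => simp [rightMul, HopfAlgebra.antipode_mul_antidistrib, mul_assoc]
  | add c d hc hd => simp only [map_add, hc, hd, mul_add, add_mul]

theorem leftMul_comul (h : A) :
    leftMul k A (Coalgebra.comul (R := k) h) = algebraMap k A (Coalgebra.counit h) :=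
  HopfAlgebra.mul_antipode_rTensor_comul_apply h

theorem rightMul_comul (h : A) :
    rightMul k A (Coalgebra.comul (R := k) h) = algebraMap k A (Coalgebra.counit h) :=
  HopfAlgebra.mul_antipode_lTensor_comul_apply h

theorem leftMul_comul_mul (h : A) (x : A ⊗[k] A) :
    leftMul k A (Coalgebra.comul (R := k) h * x) =
      algebraMap k A (Coalgebra.counit h) * leftMul k A x := by
  induction x with
  | zero => simp
  | tmul c d =>
    rw [leftMul_mul_tmul, leftMul_comul, ← Algebra.commutes]
    simp [leftMul, mul_assoc]
  | add c d hc hd => simp only [map_add, hc, hd, mul_add]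

theorem rightMul_mul_comul (h : A) (x : A ⊗[k] A) :
    rightMul k A (x * Coalgebra.comul (R := k) h) =
      algebraMap k A (Coalgebra.counit h) * rightMul k A x := by
  induction x with
  | zero => simp
  | tmul c d =>
    rw [rightMul_tmul_mul, rightMul_comul, ← Algebra.commutes]
    simp [rightMul, mul_assoc]
  | add c d hc hd => simp only [map_add, hc, hd, add_mul, mul_add]

/-- The map `x ⊗ y ⊗ z ↦ x S(y) z`. -/
noncomputable def midMul (k A : Type*) [CommRing k] [Ring A] [HopfAlgebra k A] :
    A ⊗[k] (A ⊗[k] A) →ₗ[k] A :=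
  LinearMap.mul' k A ∘ₗ (leftMul k A).lTensor A

theorem midMul_mul (a d : A) (z u : A ⊗[k] A) :
    midMul k A ((a ⊗ₜ[k] z) * Algebra.TensorProduct.assoc k k k A A A (u ⊗ₜ[k] d)) =
      a * rightMul k A u * leftMul k A z * d := by
  induction z with
  | zero => simp
  | add c e hc he => simp only [TensorProduct.tmul_add, map_add, hc, he, add_mul, mul_add]
  | tmul p q =>
    induction u with
    | zero => simp
    | add c e hc he => simp only [TensorProduct.add_tmul, map_add, hc, he, add_mul, mul_add]
    | tmul r s =>
      simp [midMul, leftMul, rightMul, HopfAlgebra.antipode_mul_antidistrib, mul_assoc]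

theorem midMul_map (x y : A ⊗[k] A) :
    midMul k A (Algebra.TensorProduct.map (AlgHom.id k A) (Bialgebra.comulAlgHom k A) x *
        Algebra.TensorProduct.assoc k k k A A A
          (Algebra.TensorProduct.map (Bialgebra.comulAlgHom k A) (AlgHom.id k A) y)) =
      Algebra.TensorProduct.rid k k A
          (Algebra.TensorProduct.map (AlgHom.id k A) (Bialgebra.counitAlgHom k A) x) *
        Algebra.TensorProduct.lid k A
          (Algebra.TensorProduct.map (Bialgebra.counitAlgHom k A) (AlgHom.id k A) y) := by
  induction x with
  | zero => simp
  | add c e hc he => simp only [map_add, hc, he, add_mul]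
  | tmul a b =>
    induction y with
    | zero => simp
    | add c e hc he => simp only [map_add, hc, he, mul_add]
    | tmul c d =>
      simp only [Algebra.TensorProduct.map_tmul, AlgHom.id_apply, Bialgebra.comulAlgHom_apply,
        midMul_mul, leftMul_comul, rightMul_comul, Bialgebra.counitAlgHom_apply,
        Algebra.TensorProduct.rid_tmul, Algebra.TensorProduct.lid_tmul, Algebra.algebraMap_eq_smul_one]
      simp [smul_comm (Coalgebra.counit (R := k) b)]

theorem counit_left_inv :
    Algebra.TensorProduct.lid k A (Algebra.TensorProduct.map (Bialgebra.counitAlgHom k A)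
      (AlgHom.id k A) (↑T.J⁻¹ : A ⊗[k] A)) = 1 := by
  have := congrArg (fun x => Algebra.TensorProduct.lid k A (Algebra.TensorProduct.map
    (Bialgebra.counitAlgHom k A) (AlgHom.id k A) x)) T.J.inv_mul
  simpa only [map_mul, T.counit_left, mul_one, map_one] using this

theorem counit_right_inv :
    Algebra.TensorProduct.rid k k A (Algebra.TensorProduct.map (AlgHom.id k A)
      (Bialgebra.counitAlgHom k A) (↑T.J⁻¹ : A ⊗[k] A)) = 1 := by
  have := congrArg (fun x => Algebra.TensorProduct.rid k k A (Algebra.TensorProduct.map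
    (AlgHom.id k A) (Bialgebra.counitAlgHom k A) x)) T.J.inv_mul
  simpa only [map_mul, T.counit_right, mul_one, map_one] using this

theorem vInv_mul_v : T.vInv * T.v = 1 := by
  have h1 := midMul_map (k := k) (A := A) (↑T.J⁻¹) (↑T.J)
  rw [T.counit_left, T.counit_right_inv, mul_one] at h1
  have h2 := midMul_mul (k := k) (1 : A) 1 (↑T.J) (↑T.J⁻¹)
  rw [one_mul, mul_one] at h2
  change _ = T.vInv * T.v at h2
  rw [← h1, ← h2]
  congr 1
  have hc := T.cocycle
  rw [map_mul] at hc
  set Q := Algebra.TensorProduct.map (AlgHom.id k A) (Bialgebra.comulAlgHom k A)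
  set as := Algebra.TensorProduct.assoc k k k A A A
  have e1 : as ((↑T.J : A ⊗[k] A) ⊗ₜ[k] (1 : A)) * as ((↑T.J⁻¹ : A ⊗[k] A) ⊗ₜ[k] (1 : A)) = 1 := by
    rw [← map_mul, Algebra.TensorProduct.tmul_mul_tmul, T.J.mul_inv, mul_one]
    exact map_one _
  have e2 : Q (↑T.J⁻¹ : A ⊗[k] A) * Q (↑T.J : A ⊗[k] A) = 1 := by
    rw [← map_mul, T.J.inv_mul, map_one]
  calc ((1 : A) ⊗ₜ[k] (↑T.J : A ⊗[k] A)) * as ((↑T.J⁻¹ : A ⊗[k] A) ⊗ₜ[k] (1 : A))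
      = Q (↑T.J⁻¹ : A ⊗[k] A) * (Q (↑T.J : A ⊗[k] A) * ((1 : A) ⊗ₜ[k] (↑T.J : A ⊗[k] A))) *
          as ((↑T.J⁻¹ : A ⊗[k] A) ⊗ₜ[k] (1 : A)) := by rw [← mul_assoc (Q _) (Q _), e2, one_mul]
    _ = _ := by rw [← hc, ← mul_assoc, mul_assoc _ (as _) (as _), e1, mul_one]

/-- The twisted antipode `S^J(h) = v⁻¹ S(h) v`. -/
noncomputable def antipode : A →ₗ[k] A :=
  LinearMap.mulLeft k T.vInv ∘ₗ LinearMap.mulRight k T.v ∘ₗ HopfAlgebra.antipode k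

theorem antipode_apply (h : A) : T.antipode h = T.vInv * HopfAlgebra.antipode k h * T.v := by
  simp [antipode, mul_assoc]

theorem antipode_left_apply (h : A) :
    LinearMap.mul' k A (T.antipode.rTensor A (T.comul h)) =
      algebraMap k A (Coalgebra.counit h) := by
  have key : ∀ x : A ⊗[k] A, LinearMap.mul' k A (T.antipode.rTensor A x) =
      T.vInv * leftMul k A (↑T.J * x) := by
    intro x
    induction x with
    | zero => simp
    | add c e hc he => simp only [map_add, hc, he, mul_add]
    | tmul a b => simp [leftMul_mul_tmul, antipode_apply, v, mul_assoc]
  rw [key, comul_apply, ← mul_assoc, ← mul_assoc, T.J.mul_inv, one_mul, leftMul_comul_mul,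
    ← mul_assoc, ← Algebra.commutes, mul_assoc]
  change _ * (T.vInv * T.v) = _
  rw [vInv_mul_v, mul_one]

theorem antipode_right_apply (h : A) :
    LinearMap.mul' k A (T.antipode.lTensor A (T.comul h)) =
      algebraMap k A (Coalgebra.counit h) := by
  have key : ∀ x : A ⊗[k] A, LinearMap.mul' k A (T.antipode.lTensor A x) =
      rightMul k A (x * ↑T.J⁻¹) * T.v := by
    intro x
    induction x with
    | zero => simp
    | add c e hc he => simp only [map_add, hc, he, add_mul]
    | tmul a b => simp [rightMul_tmul_mul, antipode_apply, vInv, mul_assoc]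
  rw [key, comul_apply, mul_assoc _ (↑T.J : A ⊗[k] A), T.J.mul_inv, mul_one, rightMul_mul_comul,
    mul_assoc]
  change _ * (T.vInv * T.v) = _
  rw [vInv_mul_v, mul_one]

/-- The Hopf algebra `A^J`, as a type synonym of `A`. -/
def Twisted (_T : HopfTwist k A) : Type _ := A

instance : Ring T.Twisted := inferInstanceAs (Ring A)

instance : Algebra k T.Twisted := inferInstanceAs (Algebra k A)

/-- The identity map `A = A^J`, an isomorphism of algebras. -/
def toTwisted : A ≃ₐ[k] T.Twisted := AlgEquiv.refl



/-- The comultiplication `Δ^J` on `A^J`. -/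
noncomputable def comulTwisted : T.Twisted →ₐ[k] T.Twisted ⊗[k] T.Twisted :=
  (Algebra.TensorProduct.map T.toTwisted.toAlgHom T.toTwisted.toAlgHom).comp
    (T.comul.comp T.toTwisted.symm.toAlgHom)

/-- The counit on `A^J`, which is the counit of `A`. -/
noncomputable def counitTwisted : T.Twisted →ₐ[k] k :=
  (Bialgebra.counitAlgHom k A).comp T.toTwisted.symm.toAlgHom

theorem comulTwisted_toTwisted (h : A) :
    T.comulTwisted (T.toTwisted h) =
      Algebra.TensorProduct.map T.toTwisted.toAlgHom T.toTwisted.toAlgHom (T.comul h) := by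
  simp [comulTwisted]

theorem counitTwisted_toTwisted (h : A) :
    T.counitTwisted (T.toTwisted h) = Coalgebra.counit (R := k) h := by
  simp [counitTwisted]

theorem map_comulTwisted_left (y : A ⊗[k] A) :
    Algebra.TensorProduct.assoc k k k T.Twisted T.Twisted T.Twisted
      (Algebra.TensorProduct.map T.comulTwisted (AlgHom.id k T.Twisted)
        (Algebra.TensorProduct.map T.toTwisted.toAlgHom T.toTwisted.toAlgHom y)) =
    Algebra.TensorProduct.map T.toTwisted.toAlgHom
      (Algebra.TensorProduct.map T.toTwisted.toAlgHom T.toTwisted.toAlgHom)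
      (Algebra.TensorProduct.assoc k k k A A A
        (Algebra.TensorProduct.map T.comul (AlgHom.id k A) y)) := by
  induction y with
  | zero => simp
  | add a b ha hb => simp only [map_add, ha, hb]
  | tmul a b =>
    change Algebra.TensorProduct.assoc k k k T.Twisted T.Twisted T.Twisted
      (T.comulTwisted (T.toTwisted a) ⊗ₜ[k] T.toTwisted b) = Algebra.TensorProduct.map _ _
        (Algebra.TensorProduct.assoc k k k A A A (T.comul a ⊗ₜ[k] b))
    rw [comulTwisted_toTwisted]
    generalize T.comul a = z
    induction z with
    | zero => simp
    | add a b ha hb => simp only [map_add, ha, hb, TensorProduct.add_tmul]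
    | tmul c d => simp

theorem map_comulTwisted_right (y : A ⊗[k] A) :
    Algebra.TensorProduct.map (AlgHom.id k T.Twisted) T.comulTwisted
        (Algebra.TensorProduct.map T.toTwisted.toAlgHom T.toTwisted.toAlgHom y) =
    Algebra.TensorProduct.map T.toTwisted.toAlgHom
      (Algebra.TensorProduct.map T.toTwisted.toAlgHom T.toTwisted.toAlgHom)
        (Algebra.TensorProduct.map (AlgHom.id k A) T.comul y) := by
  induction y with
  | zero => simp
  | add a b ha hb => simp only [map_add, ha, hb]
  | tmul a b => simp [comulTwisted_toTwisted]

theorem lid_map_counitTwisted (y : A ⊗[k] A) :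
    Algebra.TensorProduct.lid k T.Twisted
      (Algebra.TensorProduct.map T.counitTwisted (AlgHom.id k T.Twisted)
        (Algebra.TensorProduct.map T.toTwisted.toAlgHom T.toTwisted.toAlgHom y)) =
    T.toTwisted (Algebra.TensorProduct.lid k A
      (Algebra.TensorProduct.map (Bialgebra.counitAlgHom k A) (AlgHom.id k A) y)) := by
  induction y with
  | zero => simp
  | add a b ha hb => simp only [map_add, ha, hb]
  | tmul a b => simp [counitTwisted_toTwisted]

theorem rid_map_counitTwisted (y : A ⊗[k] A) :
    Algebra.TensorProduct.rid k k T.Twisted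
      (Algebra.TensorProduct.map (AlgHom.id k T.Twisted) T.counitTwisted
        (Algebra.TensorProduct.map T.toTwisted.toAlgHom T.toTwisted.toAlgHom y)) =
    T.toTwisted (Algebra.TensorProduct.rid k k A
      (Algebra.TensorProduct.map (AlgHom.id k A) (Bialgebra.counitAlgHom k A) y)) := by
  induction y with
  | zero => simp
  | add a b ha hb => simp only [map_add, ha, hb]
  | tmul a b => simp [counitTwisted_toTwisted]

noncomputable instance : Bialgebra k T.Twisted :=
  Bialgebra.ofAlgHom T.comulTwisted T.counitTwisted
    (AlgHom.ext fun h => by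
      obtain ⟨h, rfl⟩ := T.toTwisted.surjective h
      simp only [AlgHom.comp_apply, comulTwisted_toTwisted, map_comulTwisted_right,
        ← coassoc_apply, ← map_comulTwisted_left]
      rfl)
    (AlgHom.ext fun h => (Algebra.TensorProduct.lid k T.Twisted).injective (by
      obtain ⟨h, rfl⟩ := T.toTwisted.surjective h
      simp only [AlgHom.comp_apply, comulTwisted_toTwisted, lid_map_counitTwisted,
        counit_left_apply]
      simp))
    (AlgHom.ext fun h => (Algebra.TensorProduct.rid k k T.Twisted).injective (by
      obtain ⟨h, rfl⟩ := T.toTwisted.surjective h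
      simp only [AlgHom.comp_apply, comulTwisted_toTwisted, rid_map_counitTwisted,
        counit_right_apply]
      simp))

theorem comul_toTwisted (h : A) :
    Coalgebra.comul (R := k) (T.toTwisted h) =
      Algebra.TensorProduct.map T.toTwisted.toAlgHom T.toTwisted.toAlgHom (T.comul h) :=
  T.comulTwisted_toTwisted h

theorem counit_toTwisted (h : A) :
    Coalgebra.counit (R := k) (T.toTwisted h) = Coalgebra.counit (R := k) h :=
  T.counitTwisted_toTwisted h

/-- The antipode `S^J` on `A^J`. -/
noncomputable def antipodeTwisted : T.Twisted →ₗ[k] T.Twisted :=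
  T.toTwisted.toLinearMap ∘ₗ T.antipode ∘ₗ T.toTwisted.symm.toLinearMap

theorem mul_antipodeTwisted_left (y : A ⊗[k] A) :
    LinearMap.mul' k T.Twisted (T.antipodeTwisted.rTensor T.Twisted
      (Algebra.TensorProduct.map T.toTwisted.toAlgHom T.toTwisted.toAlgHom y)) =
    T.toTwisted (LinearMap.mul' k A (T.antipode.rTensor A y)) := by
  induction y with
  | zero => simp
  | add a b ha hb => simp only [map_add, ha, hb]
  | tmul a b => simp [antipodeTwisted]

theorem mul_antipodeTwisted_right (y : A ⊗[k] A) :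
    LinearMap.mul' k T.Twisted (T.antipodeTwisted.lTensor T.Twisted
      (Algebra.TensorProduct.map T.toTwisted.toAlgHom T.toTwisted.toAlgHom y)) =
    T.toTwisted (LinearMap.mul' k A (T.antipode.lTensor A y)) := by
  induction y with
  | zero => simp
  | add a b ha hb => simp only [map_add, ha, hb]
  | tmul a b => simp [antipodeTwisted]

noncomputable instance : HopfAlgebra k T.Twisted where
  antipode := T.antipodeTwisted
  mul_antipode_rTensor_comul := LinearMap.ext fun h => by
    obtain ⟨h, rfl⟩ := T.toTwisted.surjective h
    simp only [LinearMap.comp_apply, comul_toTwisted, mul_antipodeTwisted_left,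
      antipode_left_apply, counit_toTwisted]
    simp
  mul_antipode_lTensor_comul := LinearMap.ext fun h => by
    obtain ⟨h, rfl⟩ := T.toTwisted.surjective h
    simp only [LinearMap.comp_apply, comul_toTwisted, mul_antipodeTwisted_right,
      antipode_right_apply, counit_toTwisted]
    simp

end HopfTwist

/-- The left adjoint coaction `a ↦ ∑ a₁ S(a₃) ⊗ a₂` of a Hopf algebra on itself, the dual of the
left adjoint action `h ⊗ x ↦ ∑ h₁ x S(h₂)`. -/
noncomputable def adjointCoaction (k A : Type*) [CommRing k] [Ring A] [HopfAlgebra k A] :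
    A →ₗ[k] A ⊗[k] A :=
  (LinearMap.mul' k A ∘ₗ (HopfAlgebra.antipode k (A := A)).lTensor A).rTensor A ∘ₗ
    (TensorProduct.assoc k A A A).symm.toLinearMap ∘ₗ
    (TensorProduct.comm k A A).toLinearMap.lTensor A ∘ₗ
    (Coalgebra.comul (R := k) (A := A)).lTensor A ∘ₗ Coalgebra.comul

/-- A quotient Hopf algebra `π : A → B` is (co)normal if the left adjoint coaction of `A` descends
to `B`, that is, if it maps `ker π` into `A ⊗ ker π = ker (id ⊗ π)`. This is the arrow-reversal of
normality of a Hopf subalgebra, i.e. of stability under the left adjoint action. -/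
def IsNormalQuotient {k A B : Type*} [Field k] [Ring A] [Ring B] [HopfAlgebra k A]
    [HopfAlgebra k B] (π : A →ₐc[k] B) : Prop :=
  ∀ a : A, π a = 0 →
    ((π : A →ₗc[k] B) : A →ₗ[k] B).lTensor A (adjointCoaction k A a) = 0

/-- Normalized 2-cocycles `ω : Γ × Γ → kˣ` (for the trivial action). -/
structure NormalizedTwoCocycle (Γ k : Type*) [Group Γ] [Field k] where
  /-- The underlying function. -/
  toFun : Γ → Γ → kˣ
  map_one_left : ∀ a, toFun 1 a = 1
  map_one_right : ∀ a, toFun a 1 = 1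
  cocycle : ∀ a b c, toFun (a * b) c * toFun a b = toFun a (b * c) * toFun b c

namespace NormalizedTwoCocycle

variable {Γ k : Type*} [Group Γ] [Field k] (ω : NormalizedTwoCocycle Γ k)

/-- An element `g` is `ω`-regular if `ω(g, h) = ω(h, g)` for all `h` in the centralizer of `g`. -/
def IsRegular (g : Γ) : Prop :=
  ∀ h ∈ Subgroup.centralizer {g}, ω.toFun g h = ω.toFun h g

/-- `ω` is non-degenerate if the identity is the only `ω`-regular element. -/
def IsNondegenerate : Prop :=
  ∀ g : Γ, ω.IsRegular g → g = 1

end NormalizedTwoCocycle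

namespace GroupTwist

theorem sum_char_eq_zero {k C : Type*} [Field k] [Group C] [Fintype C] (χ : C →* kˣ)
    (hχ : χ ≠ 1) : ∑ h : C, ((χ h : kˣ) : k) = 0 :=
  sum_hom_units_eq_zero ((Units.coeHom k).comp χ)
    fun h => hχ (MonoidHom.ext fun x => Units.ext (DFunLike.congr_fun h x))

theorem sum_eval_eq_zero {k C : Type*} [Field k] [IsAlgClosed k] [CharZero k] [CommGroup C]
    [Finite C] [Fintype (C →* kˣ)] (h : C) (hh : h ≠ 1) :
    ∑ χ : C →* kˣ, ((χ h : kˣ) : k) = 0 := by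
  have : NeZero (Monoid.exponent C : k) :=
    ⟨Nat.cast_ne_zero.mpr Monoid.exponent_ne_zero_of_finite⟩
  obtain ⟨φ, hφ⟩ := CommGroup.exists_apply_ne_one_of_hasEnoughRootsOfUnity C k hh
  exact sum_hom_units_eq_zero ((Units.coeHom k).comp (MonoidHom.eval h : (C →* kˣ) →* kˣ))
    fun e => hφ (Units.ext (DFunLike.congr_fun e φ))

theorem card_char {k C : Type*} [Field k] [IsAlgClosed k] [CharZero k] [CommGroup C]
    [Finite C] [Fintype (C →* kˣ)] : Fintype.card (C →* kˣ) = Nat.card C := by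
  have : NeZero (Monoid.exponent C : k) :=
    ⟨Nat.cast_ne_zero.mpr Monoid.exponent_ne_zero_of_finite⟩
  rw [← Nat.card_eq_fintype_card]
  exact CommGroup.card_monoidHom_of_hasEnoughRootsOfUnity C k

section

set_option linter.unusedSectionVars false

attribute [local instance] Fintype.ofFinite

variable {k : Type*} [Field k] {G : Type*} [Group G] [Finite G] (H : Subgroup G)

/-- The idempotent `e_χ = |H|⁻¹ ∑_{h ∈ H} χ(h⁻¹) h` in `kG`, for a character `χ` of `H`. -/
noncomputable def idem (χ : H →* kˣ) : MonoidAlgebra k G :=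
  (Nat.card H : k)⁻¹ • ∑ h : H, MonoidAlgebra.single (h : G) ((χ h⁻¹ : kˣ) : k)

/-- The element `∑_{α, β} f(α, β) e_α ⊗ e_β`, the sum being over the characters of `H`. -/
noncomputable def tensorSum (f : (H →* kˣ) → (H →* kˣ) → kˣ) :
    MonoidAlgebra k G ⊗[k] MonoidAlgebra k G :=
  ∑ α : H →* kˣ, ∑ β : H →* kˣ, ((f α β : kˣ) : k) • (idem H α ⊗ₜ[k] idem H β)

/-- The element `∑_{α, β, γ} f(α, β, γ) e_α ⊗ e_β ⊗ e_γ`. -/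
noncomputable def tensorSum₃ (f : (H →* kˣ) → (H →* kˣ) → (H →* kˣ) → kˣ) :
    MonoidAlgebra k G ⊗[k] (MonoidAlgebra k G ⊗[k] MonoidAlgebra k G) :=
  ∑ α : H →* kˣ, ∑ β : H →* kˣ, ∑ γ : H →* kˣ,
    ((f α β γ : kˣ) : k) • (idem H α ⊗ₜ[k] (idem H β ⊗ₜ[k] idem H γ))

theorem inv_ne_one_of_ne {χ : H →* kˣ} (h : χ ≠ 1) : χ⁻¹ ≠ 1 := fun h' => h <| by
  ext x
  simpa using congrArg (fun φ : H →* kˣ => ((φ x⁻¹ : kˣ) : k)) h'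

theorem inv_mul_ne_one_of_ne {χ ψ : H →* kˣ} (h : χ ≠ ψ) : χ⁻¹ * ψ ≠ 1 := fun h' => h <| by
  refine MonoidHom.ext fun x => ?_
  have := DFunLike.congr_fun h' x
  rwa [MonoidHom.mul_apply, MonoidHom.inv_apply, MonoidHom.one_apply, inv_mul_eq_one] at this

theorem single_mul_idem (χ : H →* kˣ) (h : H) :
    MonoidAlgebra.single (h : G) (1 : k) * idem H χ = ((χ h : kˣ) : k) • idem H χ := by
  rw [idem, mul_smul_comm, smul_comm]
  congr 1
  rw [Finset.mul_sum, Finset.smul_sum]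
  refine Fintype.sum_equiv (Equiv.mulLeft h) _ _ fun x => ?_
  have hx : (χ x⁻¹ : kˣ) = χ h * χ (h * x)⁻¹ := by
    rw [map_inv, map_inv, map_mul, mul_inv, mul_inv_cancel_left]
  simp only [MonoidAlgebra.single_mul_single, MonoidAlgebra.smul_single, one_mul, hx,
    Equiv.coe_mulLeft, Subgroup.coe_mul, Units.val_mul, smul_eq_mul]

theorem idem_eq_sum_smul (χ : H →* kˣ) :
    idem H χ = (Nat.card H : k)⁻¹ •
      ∑ h : H, ((χ h⁻¹ : kˣ) : k) • MonoidAlgebra.single (h : G) (1 : k) := by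
  simp [idem, MonoidAlgebra.smul_single]

theorem idem_mul_self [CharZero k] (χ : H →* kˣ) : idem H χ * idem H χ = idem H χ := by
  have hn : (Nat.card H : k) ≠ 0 := by simp
  nth_rewrite 1 [idem_eq_sum_smul]
  rw [smul_mul_assoc, Finset.sum_mul]
  have : ∀ h : H, (((χ h⁻¹ : kˣ) : k) • MonoidAlgebra.single (h : G) (1 : k)) * idem H χ =
      idem H χ := by
    intro h
    rw [smul_mul_assoc, single_mul_idem, smul_smul]
    simp
  simp only [this, Finset.sum_const, Finset.card_univ]
  rw [← Nat.cast_smul_eq_nsmul k, smul_smul, ← Nat.card_eq_fintype_card, inv_mul_cancel₀ hn,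
    one_smul]

theorem idem_mul_of_ne (χ ψ : H →* kˣ) (hne : χ ≠ ψ) : idem H χ * idem H ψ = 0 := by
  rw [idem_eq_sum_smul, smul_mul_assoc, Finset.sum_mul]
  have : ∀ h : H, (((χ h⁻¹ : kˣ) : k) • MonoidAlgebra.single (h : G) (1 : k)) * idem H ψ =
      (((χ⁻¹ * ψ) h : kˣ) : k) • idem H ψ := by
    intro h
    rw [smul_mul_assoc, single_mul_idem, smul_smul]
    simp
  simp only [this]
  rw [← Finset.sum_smul, sum_char_eq_zero _ (inv_mul_ne_one_of_ne H hne), zero_smul,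
    smul_zero]

theorem counit_idem_one [CharZero k] :
    Coalgebra.counit (R := k) (idem H (1 : H →* kˣ) : MonoidAlgebra k G) = 1 := by
  simp [idem]

theorem counit_idem_of_ne (χ : H →* kˣ) (hne : χ ≠ 1) :
    Coalgebra.counit (R := k) (idem H χ) = 0 := by
  have := sum_char_eq_zero χ⁻¹ (inv_ne_one_of_ne H hne)
  simp only [MonoidHom.inv_apply] at this
  simp only [idem, map_smul, map_sum, MonoidAlgebra.counit_single, CommSemiring.counit_apply,
    smul_eq_mul, map_inv]
  rw [this, mul_zero]

variable [IsAlgClosed k] [CharZero k] [IsMulCommutative H]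

open scoped IsMulCommutative in
theorem sum_smul_idem (h : H) :
    ∑ χ : H →* kˣ, ((χ h : kˣ) : k) • idem H χ = MonoidAlgebra.single (h : G) (1 : k) := by
  simp only [idem_eq_sum_smul, Finset.smul_sum]
  rw [Finset.sum_comm]
  have hx : ∀ x : H, ∑ χ : H →* kˣ, ((χ h : kˣ) : k) • (Nat.card H : k)⁻¹ • ((χ x⁻¹ : kˣ) : k) •
      MonoidAlgebra.single (x : G) (1 : k) =
      ((Nat.card H : k)⁻¹ * ∑ χ : H →* kˣ, ((χ (h * x⁻¹) : kˣ) : k)) •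
        MonoidAlgebra.single (x : G) (1 : k) := by
    intro x
    rw [Finset.mul_sum, Finset.sum_smul]
    refine Finset.sum_congr rfl fun χ _ => ?_
    rw [smul_smul, smul_smul, map_mul, Units.val_mul]
    congr 1
    ring
  simp only [hx]
  rw [Finset.sum_eq_single_of_mem h (Finset.mem_univ h)]
  · have hc : Fintype.card (H →* kˣ) = Nat.card H := card_char
    simp [hc]
  · intro x _ hxh
    have h0 : ∑ χ : H →* kˣ, ((χ (h * x⁻¹) : kˣ) : k) = 0 :=
      sum_eval_eq_zero _ fun h' => hxh (mul_inv_eq_one.mp h').symm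
    rw [h0, mul_zero, zero_smul]

theorem sum_idem : ∑ χ : H →* kˣ, idem H χ = (1 : MonoidAlgebra k G) := by
  have := sum_smul_idem (k := k) H 1
  simpa [MonoidAlgebra.one_def] using this

theorem comul_idem (χ : H →* kˣ) :
    Coalgebra.comul (R := k) (idem H χ) =
      ∑ α : H →* kˣ, idem H α ⊗ₜ[k] idem H (α⁻¹ * χ) := by
  have h1 : Coalgebra.comul (R := k) (idem H χ) = (Nat.card H : k)⁻¹ • ∑ h : H,
      ((χ h⁻¹ : kˣ) : k) • (MonoidAlgebra.single (h : G) (1 : k) ⊗ₜ[k]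
        MonoidAlgebra.single (h : G) (1 : k)) := by
    rw [idem_eq_sum_smul]
    simp only [map_smul, map_sum, MonoidAlgebra.comul_single, CommSemiring.comul_apply,
      TensorProduct.map_tmul, MonoidAlgebra.lsingle_apply]
  rw [h1]
  have h2 : ∀ h : H, ((χ h⁻¹ : kˣ) : k) • (MonoidAlgebra.single (h : G) (1 : k) ⊗ₜ[k]
        MonoidAlgebra.single (h : G) (1 : k)) =
      ∑ α : H →* kˣ, idem H α ⊗ₜ[k] ((((α⁻¹ * χ) h⁻¹ : kˣ) : k) •
        MonoidAlgebra.single (h : G) (1 : k)) := by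
    intro h
    conv_lhs => rw [← sum_smul_idem (k := k) H h, TensorProduct.sum_tmul, Finset.smul_sum]
    refine Finset.sum_congr rfl fun α _ => ?_
    rw [sum_smul_idem, TensorProduct.smul_tmul, ← TensorProduct.tmul_smul, smul_smul]
    congr 2
    simp [mul_comm]
  simp only [h2]
  rw [Finset.sum_comm, Finset.smul_sum]
  refine Finset.sum_congr rfl fun α _ => ?_
  rw [← TensorProduct.tmul_sum, ← TensorProduct.tmul_smul, ← idem_eq_sum_smul]

theorem sum_smul_mul_sum_smul {k R ι : Type*} [Field k] [Ring R] [Algebra k R] [Fintype ι]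
    (E : ι → R) (h1 : ∀ i, E i * E i = E i) (h0 : ∀ i j, i ≠ j → E i * E j = 0) (c d : ι → k) :
    (∑ i, c i • E i) * (∑ i, d i • E i) = ∑ i, (c i * d i) • E i := by
  rw [Finset.sum_mul]
  refine Finset.sum_congr rfl fun i _ => ?_
  rw [Finset.mul_sum, Finset.sum_eq_single_of_mem i (Finset.mem_univ i), smul_mul_smul_comm, h1]
  intro j _ hj
  rw [smul_mul_smul_comm, h0 i j hj.symm, smul_zero]

theorem tensorSum_mul (f g : (H →* kˣ) → (H →* kˣ) → kˣ) :
    tensorSum H f * tensorSum H g = tensorSum H fun α β => f α β * g α β := by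
  have := sum_smul_mul_sum_smul (k := k) (ι := (H →* kˣ) × (H →* kˣ))
    (fun i => (idem H i.1 : MonoidAlgebra k G) ⊗ₜ[k] (idem H i.2 : MonoidAlgebra k G))
    (fun i => by rw [Algebra.TensorProduct.tmul_mul_tmul, idem_mul_self, idem_mul_self])
    (fun i j hij => by
      rw [Algebra.TensorProduct.tmul_mul_tmul]
      by_cases h : i.1 = j.1
      · rw [idem_mul_of_ne H i.2 j.2 fun h' => hij (Prod.ext h h'), TensorProduct.tmul_zero]
      · rw [idem_mul_of_ne H _ _ h, TensorProduct.zero_tmul])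
    (fun i => (f i.1 i.2 : k)) (fun i => (g i.1 i.2 : k))
  simp only [Fintype.sum_prod_type, ← Units.val_mul] at this
  exact this

theorem tensorSum₃_mul (f g : (H →* kˣ) → (H →* kˣ) → (H →* kˣ) → kˣ) :
    tensorSum₃ H f * tensorSum₃ H g = tensorSum₃ H fun α β γ => f α β γ * g α β γ := by
  have := sum_smul_mul_sum_smul (k := k) (ι := (H →* kˣ) × (H →* kˣ) × (H →* kˣ))
    (fun i => (idem H i.1 : MonoidAlgebra k G) ⊗ₜ[k]
      ((idem H i.2.1 : MonoidAlgebra k G) ⊗ₜ[k] (idem H i.2.2 : MonoidAlgebra k G)))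
    (fun i => by simp only [Algebra.TensorProduct.tmul_mul_tmul, idem_mul_self])
    (fun i j hij => by
      simp only [Algebra.TensorProduct.tmul_mul_tmul]
      by_cases h : i.1 = j.1
      · by_cases h2 : i.2.1 = j.2.1
        · rw [idem_mul_of_ne H i.2.2 j.2.2 fun h' => hij (Prod.ext h (Prod.ext h2 h')),
            TensorProduct.tmul_zero, TensorProduct.tmul_zero]
        · rw [idem_mul_of_ne H _ _ h2, TensorProduct.zero_tmul, TensorProduct.tmul_zero]
      · rw [idem_mul_of_ne H _ _ h, TensorProduct.zero_tmul])
    (fun i => (f i.1 i.2.1 i.2.2 : k)) (fun i => (g i.1 i.2.1 i.2.2 : k))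
  simp only [Fintype.sum_prod_type, ← Units.val_mul] at this
  exact this

theorem tensorSum_one : tensorSum H (fun _ _ => 1) =
    (1 : MonoidAlgebra k G ⊗[k] MonoidAlgebra k G) := by
  simp only [tensorSum, Units.val_one, one_smul, ← TensorProduct.tmul_sum,
    ← TensorProduct.sum_tmul, sum_idem, Algebra.TensorProduct.one_def]

theorem tensorSum_tmul_one (f : (H →* kˣ) → (H →* kˣ) → kˣ) :
    Algebra.TensorProduct.assoc k k k (MonoidAlgebra k G) (MonoidAlgebra k G) (MonoidAlgebra k G)
      (tensorSum H f ⊗ₜ[k] (1 : MonoidAlgebra k G)) = tensorSum₃ H fun α β _ => f α β := by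
  simp only [tensorSum, tensorSum₃, TensorProduct.sum_tmul, map_sum,
    ← TensorProduct.smul_tmul', map_smul, Algebra.TensorProduct.assoc_tmul, ← Finset.smul_sum,
    ← TensorProduct.tmul_sum, sum_idem]

theorem one_tmul_tensorSum (f : (H →* kˣ) → (H →* kˣ) → kˣ) :
    (1 : MonoidAlgebra k G) ⊗ₜ[k] tensorSum H f = tensorSum₃ H fun _ β γ => f β γ := by
  conv_lhs => rw [← sum_idem (k := k) H, TensorProduct.sum_tmul]
  simp only [tensorSum, tensorSum₃, TensorProduct.tmul_sum, TensorProduct.tmul_smul]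

theorem map_comul_left_tensorSum (f : (H →* kˣ) → (H →* kˣ) → kˣ) :
    Algebra.TensorProduct.assoc k k k (MonoidAlgebra k G) (MonoidAlgebra k G) (MonoidAlgebra k G)
      (Algebra.TensorProduct.map (Bialgebra.comulAlgHom k (MonoidAlgebra k G))
        (AlgHom.id k (MonoidAlgebra k G)) (tensorSum H f)) =
      tensorSum₃ H fun α β γ => f (α * β) γ := by
  simp only [tensorSum, tensorSum₃, map_sum, map_smul, Algebra.TensorProduct.map_tmul,
    Bialgebra.comulAlgHom_apply, comul_idem, AlgHom.id_apply, TensorProduct.sum_tmul,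
    Algebra.TensorProduct.assoc_tmul]
  -- reorder the sums and substitute `χ = α * β` in the inner one
  calc _ = ∑ χ : H →* kˣ, ∑ α : H →* kˣ, ∑ γ : H →* kˣ,
        ((f χ γ : kˣ) : k) • (idem (k := k) H α ⊗ₜ[k] (idem H (α⁻¹ * χ) ⊗ₜ[k] idem H γ)) := by
        refine Finset.sum_congr rfl fun χ _ => ?_
        rw [Finset.sum_comm]
        simp only [Finset.smul_sum]
    _ = ∑ α : H →* kˣ, ∑ χ : H →* kˣ, ∑ γ : H →* kˣ,
        ((f χ γ : kˣ) : k) • (idem (k := k) H α ⊗ₜ[k] (idem H (α⁻¹ * χ) ⊗ₜ[k] idem H γ)) :=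
        Finset.sum_comm
    _ = _ := by
        refine Finset.sum_congr rfl fun α _ => ?_
        refine (Fintype.sum_equiv (Equiv.mulLeft α) _ _ fun β => ?_).symm
        rw [Equiv.coe_mulLeft, inv_mul_cancel_left α β]

theorem map_comul_right_tensorSum (f : (H →* kˣ) → (H →* kˣ) → kˣ) :
    Algebra.TensorProduct.map (AlgHom.id k (MonoidAlgebra k G))
      (Bialgebra.comulAlgHom k (MonoidAlgebra k G)) (tensorSum H f) =
      tensorSum₃ H fun α β γ => f α (β * γ) := by
  simp only [tensorSum, tensorSum₃, map_sum, map_smul, Algebra.TensorProduct.map_tmul,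
    Bialgebra.comulAlgHom_apply, comul_idem, AlgHom.id_apply, TensorProduct.tmul_sum,
    Finset.smul_sum]
  refine Finset.sum_congr rfl fun α _ => ?_
  rw [Finset.sum_comm]
  refine Finset.sum_congr rfl fun β _ => ?_
  refine (Fintype.sum_equiv (Equiv.mulLeft β) _ _ fun γ => ?_).symm
  rw [Equiv.coe_mulLeft, inv_mul_cancel_left β γ]

/-- The twist `J = ∑_{α, β} ω(α, β) e_α ⊗ e_β` in `kG`, lifted from the abelian subgroup `H`, of a
normalized 2-cocycle `ω` on the character group of `H`. -/
noncomputable def twist (ω : NormalizedTwoCocycle (H →* kˣ) k) :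
    HopfTwist k (MonoidAlgebra k G) where
  J :=
    { val := tensorSum H ω.toFun
      inv := tensorSum H fun α β => (ω.toFun α β)⁻¹
      val_inv := by rw [tensorSum_mul, ← tensorSum_one (k := k) H]; simp
      inv_val := by rw [tensorSum_mul, ← tensorSum_one (k := k) H]; simp }
  cocycle := by
    rw [map_mul]
    change Algebra.TensorProduct.assoc k k k _ _ _ (Algebra.TensorProduct.map _ _
      (tensorSum H ω.toFun)) * Algebra.TensorProduct.assoc k k k _ _ _
        (tensorSum H ω.toFun ⊗ₜ[k] 1) = Algebra.TensorProduct.map _ _ (tensorSum H ω.toFun) *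
          ((1 : MonoidAlgebra k G) ⊗ₜ[k] tensorSum H ω.toFun)
    rw [map_comul_left_tensorSum, map_comul_right_tensorSum, tensorSum_tmul_one,
      one_tmul_tensorSum, tensorSum₃_mul, tensorSum₃_mul]
    congr 1
    funext α β γ
    exact ω.cocycle α β γ
  counit_left := by
    change Algebra.TensorProduct.lid k _ (Algebra.TensorProduct.map _ _ (tensorSum H ω.toFun)) = 1
    simp only [tensorSum, map_sum, map_smul, Algebra.TensorProduct.map_tmul, AlgHom.id_apply,
      Algebra.TensorProduct.lid_tmul, Bialgebra.counitAlgHom_apply]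
    rw [Finset.sum_eq_single_of_mem 1 (Finset.mem_univ _), ← sum_idem (k := k) H]
    · refine Finset.sum_congr rfl fun β _ => ?_
      rw [counit_idem_one, ω.map_one_left, Units.val_one, one_smul, one_smul]
    · intro α _ hα
      refine Finset.sum_eq_zero fun β _ => ?_
      rw [counit_idem_of_ne _ _ hα, zero_smul, smul_zero]
  counit_right := by
    change Algebra.TensorProduct.rid k k _
      (Algebra.TensorProduct.map _ _ (tensorSum H ω.toFun)) = 1
    simp only [tensorSum, map_sum, map_smul, Algebra.TensorProduct.map_tmul, AlgHom.id_apply,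
      Algebra.TensorProduct.rid_tmul, Bialgebra.counitAlgHom_apply]
    rw [Finset.sum_comm, Finset.sum_eq_single_of_mem 1 (Finset.mem_univ _),
      ← sum_idem (k := k) H]
    · refine Finset.sum_congr rfl fun β _ => ?_
      rw [counit_idem_one, ω.map_one_right, Units.val_one, one_smul, one_smul]
    · intro α _ hα
      refine Finset.sum_eq_zero fun β _ => ?_
      rw [counit_idem_of_ne _ _ hα, zero_smul, smul_zero]

end

/-- The restriction to `G` of the character `μ ∘ π` of `A = (kG)^J`, for a quotient `π : A → kF`
and a character `μ` of `F` (extended linearly to `kF`). -/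
noncomputable def pullbackChar {k : Type*} [Field k] {G F : Type*} [Group G] [Group F]
    {T : HopfTwist k (MonoidAlgebra k G)} (π : T.Twisted →ₐc[k] MonoidAlgebra k F)
    (μ : F →* kˣ) : G →* kˣ :=
  MonoidHom.toHomUnits <|
    ((MonoidAlgebra.lift k k F ((Units.coeHom k).comp μ)).comp
      ((π : T.Twisted →ₐ[k] MonoidAlgebra k F).comp T.toTwisted.toAlgHom) :
        MonoidAlgebra k G →* k).comp (MonoidAlgebra.of k G)

end GroupTwist

/-! Since `F` is abelian, the characters `μ` of `F` separate `A ⊗ kF`, so normality can be tested on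
one character `φ = μ ∘ π` at a time (`isNormalQuotient_iff`). Pairing the middle leg of the adjoint
coaction with `φ` gives `∑ a₁ S(L(a₂))`, where `L` and `R` are the left and right convolutions with
`φ`.

In `kG` the two convolutions coincide. In `A` they differ by an inner automorphism: let `χ = φ|_H`
and let `h ∈ H` be the element with `β(h) = ω(χ, β) / ω(β, χ)` for all `β`, which exists by duality;
then `L(a) = h⁻¹ R(a) h` (`toTwisted_leftConv_eq_conj`). Substituting this, the twist cancels up to
invertible operations, and the condition on `a ∈ ker π` becomes `c(R(a)) = 0`, where `c` is the
linear map `x ↦ x h⁻¹ x⁻¹` on `kG` (`rid_lTensor_adjointCoaction_eq_zero_iff`).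

If `χ` is regular then `h = 1`, `c` is the counit, and `ε(R(a)) = φ(a) = 0`. Conversely, suppose the
condition holds. If `h = 1`, then `χ` is regular. Otherwise `h` is not central, so its conjugacy
class has at least `p` elements and `c` has rank at least `p` (`le_finrank_range_conjMap`). As `ker
π` has codimension at most `p`, the inclusion `ker π ⊆ ker (c ∘ R)` is an equality, and `ker c ⊆ ker
π` because `R` preserves `ker π` (`apply_eq_zero_of_conjMap_eq_zero`). For `z ∈ H`, `z` commutes
with `h`, so `z - 1 ∈ ker c` and `χ(z) = 1`. Thus `χ = 1`, which is regular. -/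

/-! ### Convolution with a character, and the adjoint coaction. -/

namespace HopfAlgebra

variable {k A : Type*} [CommRing k] [Ring A] [HopfAlgebra k A]

/-- The endomorphism `a ↦ ∑ φ(a₁) a₂` given by a character `φ` of a Hopf algebra. -/
noncomputable def leftConv (φ : A →ₐ[k] k) : A →ₐ[k] A :=
  (Algebra.TensorProduct.lid k A).toAlgHom.comp
    ((Algebra.TensorProduct.map φ (AlgHom.id k A)).comp (Bialgebra.comulAlgHom k A))

/-- The endomorphism `a ↦ ∑ a₁ φ(a₂)` given by a character `φ` of a Hopf algebra. -/
noncomputable def rightConv (φ : A →ₐ[k] k) : A →ₐ[k] A :=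
  (Algebra.TensorProduct.rid k k A).toAlgHom.comp
    ((Algebra.TensorProduct.map (AlgHom.id k A) φ).comp (Bialgebra.comulAlgHom k A))

theorem leftConv_apply (φ : A →ₐ[k] k) (a : A) :
    leftConv φ a = Algebra.TensorProduct.lid k A
      (Algebra.TensorProduct.map φ (AlgHom.id k A) (Coalgebra.comul (R := k) a)) := rfl

theorem rightConv_apply (φ : A →ₐ[k] k) (a : A) :
    rightConv φ a = Algebra.TensorProduct.rid k k A
      (Algebra.TensorProduct.map (AlgHom.id k A) φ (Coalgebra.comul (R := k) a)) := rfl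

/-- The scalar `φ(a₂)` in `∑ a₁ S(a₃) φ(a₂)` can be moved inside the antipode, where it completes
`a₃` to a left convolution. -/
theorem rid_lTensor_adjointCoaction (φ : A →ₐ[k] k) (a : A) :
    TensorProduct.rid k A (φ.toLinearMap.lTensor A (adjointCoaction k A a)) =
      LinearMap.mul' k A ((antipode k ∘ₗ (leftConv φ).toLinearMap).lTensor A
        (Coalgebra.comul (R := k) a)) := by
  simp only [adjointCoaction, LinearMap.comp_apply]
  generalize Coalgebra.comul (R := k) a = z
  induction z with
  | zero => simp
  | add c e hc he => simp only [map_add, hc, he]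
  | tmul x y =>
    simp only [LinearMap.lTensor_tmul, LinearMap.comp_apply, AlgHom.toLinearMap_apply,
      leftConv_apply]
    generalize Coalgebra.comul (R := k) y = w
    induction w with
    | zero => simp
    | add c e hc he => simp only [TensorProduct.tmul_add, map_add, hc, he]
    | tmul c d => simp

/-- Coassociativity: both sides are `∑ a₁ ⊗ a₂ φ(a₃)`. Left convolution has no such property, which
is why it is later traded for the right one. -/
theorem lTensor_rightConv_comul (φ : A →ₐ[k] k) (a : A) :
    (rightConv φ).toLinearMap.lTensor A (Coalgebra.comul (R := k) a) =
      Coalgebra.comul (R := k) (rightConv φ a) := by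
  have h1 : ∀ z : A ⊗[k] A, (rightConv φ).toLinearMap.lTensor A z =
      (TensorProduct.rid k A).toLinearMap.lTensor A ((φ.toLinearMap.lTensor A).lTensor A
        ((Coalgebra.comul (R := k) (A := A)).lTensor A z)) := by
    intro z
    induction z with
    | zero => simp
    | add c e hc he => simp only [map_add, hc, he]
    | tmul x y => rfl
  have h2 : ∀ z : A ⊗[k] A, (TensorProduct.rid k A).toLinearMap.lTensor A
      ((φ.toLinearMap.lTensor A).lTensor A (TensorProduct.assoc k A A A
        ((Coalgebra.comul (R := k) (A := A)).rTensor A z))) =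
      Coalgebra.comul (R := k) (TensorProduct.rid k A (φ.toLinearMap.lTensor A z)) := by
    intro z
    induction z with
    | zero => simp
    | add c e hc he => simp only [map_add, hc, he]
    | tmul x y =>
      simp only [LinearMap.rTensor_tmul, LinearMap.lTensor_tmul, TensorProduct.rid_tmul,
        map_smul]
      generalize Coalgebra.comul (R := k) x = w
      induction w with
      | zero => simp
      | add c e hc he => simp only [TensorProduct.add_tmul, map_add, hc, he, smul_add]
      | tmul c d => simp
  rw [h1, ← Coalgebra.coassoc_apply, h2]
  rfl

/-- The action `b ▷ c = c S(b)` of `A` on itself. -/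
noncomputable def mulAntipode (k A : Type*) [CommRing k] [Ring A] [HopfAlgebra k A] :
    A →ₐ[k] Module.End k A :=
  AlgHom.ofLinearMap ((LinearMap.mul k A).flip ∘ₗ antipode k) (by ext; simp)
    (fun a b => by ext; simp [antipode_mul_antidistrib, mul_assoc])

@[simp]
theorem mulAntipode_apply (b c : A) : mulAntipode k A b c = c * antipode k b := rfl

theorem commute_lmul_mulAntipode (a b : A) :
    Commute (Algebra.lmul k A a) (mulAntipode k A b) :=
  LinearMap.ext fun c => by simp [mul_assoc]

/-- The action `(a ⊗ b) ▷ c = a c S(b)` of `A ⊗ A` on `A`. -/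
noncomputable def tensorAction (k A : Type*) [CommRing k] [Ring A] [HopfAlgebra k A] :
    A ⊗[k] A →ₐ[k] Module.End k A :=
  Algebra.TensorProduct.lift (Algebra.lmul k A) (mulAntipode k A) commute_lmul_mulAntipode

@[simp]
theorem tensorAction_tmul (a b c : A) :
    tensorAction k A (a ⊗ₜ[k] b) c = a * c * antipode k b := by
  simp [tensorAction, mul_assoc]

theorem tensorAction_one (x : A ⊗[k] A) :
    tensorAction k A x 1 = HopfTwist.rightMul k A x := by
  induction x with
  | zero => simp
  | add c e hc he => simp only [map_add, LinearMap.add_apply, hc, he]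
  | tmul a b => simp [HopfTwist.rightMul]

end HopfAlgebra

/-! ### The adjoint coaction of a twisted Hopf algebra in terms of the untwisted one. -/

namespace HopfTwist

open HopfAlgebra

variable {k A : Type*} [CommRing k] [Ring A] [HopfAlgebra k A] (T : HopfTwist k A)

/-- Expanding `S^J(h' b h) = v⁻¹ S(h) S(b) S(h') v` leaves one factor between `a` and `S(b)`, on
which `a ⊗ b` acts, and one factor on the far right, which comes out. -/
theorem mul_lTensor_antipode_conj (y : A ⊗[k] A) (h h' : A) :
    LinearMap.mul' k A ((T.antipode ∘ₗ LinearMap.mulLeft k h' ∘ₗ LinearMap.mulRight k h).lTensor A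
      y) = tensorAction k A y (T.vInv * HopfAlgebra.antipode k h) *
        (HopfAlgebra.antipode k h' * T.v) := by
  induction y with
  | zero => simp
  | add c e hc he => simp only [map_add, LinearMap.add_apply, hc, he, add_mul]
  | tmul a b => simp [antipode_apply, antipode_mul_antidistrib, mul_assoc]

theorem leftConv_toTwisted (φ : T.Twisted →ₐ[k] k) (a : A) :
    T.toTwisted.symm (leftConv φ (T.toTwisted a)) = Algebra.TensorProduct.lid k A
      (Algebra.TensorProduct.map (φ.comp T.toTwisted.toAlgHom) (AlgHom.id k A) (T.comul a)) := by
  rw [leftConv_apply, comul_toTwisted]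
  generalize T.comul a = w
  induction w with
  | zero => simp
  | add c e hc he => simp only [map_add, hc, he]
  | tmul c d => simp

theorem rightConv_toTwisted (φ : T.Twisted →ₐ[k] k) (a : A) :
    T.toTwisted.symm (rightConv φ (T.toTwisted a)) = Algebra.TensorProduct.rid k k A
      (Algebra.TensorProduct.map (AlgHom.id k A) (φ.comp T.toTwisted.toAlgHom) (T.comul a)) := by
  rw [rightConv_apply, comul_toTwisted]
  generalize T.comul a = w
  induction w with
  | zero => simp
  | add c e hc he => simp only [map_add, hc, he]
  | tmul c d => simp

/-- If left convolution with a character `φ` of `A^J` is right convolution with `φ` followed by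
conjugation with `h`, and `vInv * S(h) = J⁻¹ ▷ S(h)`, then the adjoint coaction of `A^J` paired with
`φ` is, up to invertible factors, the adjoint action on `S(h)`. -/
theorem rid_lTensor_adjointCoaction_toTwisted (φ : T.Twisted →ₐ[k] k) (h h' : A)
    (hconv : ∀ a : A, T.toTwisted.symm (leftConv φ (T.toTwisted a)) =
      h' * T.toTwisted.symm (rightConv φ (T.toTwisted a)) * h)
    (hv : tensorAction k A (↑T.J⁻¹) (HopfAlgebra.antipode k h) =
      T.vInv * HopfAlgebra.antipode k h) (a : A) :
    T.toTwisted.symm (TensorProduct.rid k T.Twisted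
      (φ.toLinearMap.lTensor T.Twisted (adjointCoaction k T.Twisted (T.toTwisted a)))) =
    tensorAction k A (↑T.J⁻¹) (tensorAction k A (Coalgebra.comul (R := k)
      (T.toTwisted.symm (rightConv φ (T.toTwisted a)))) (HopfAlgebra.antipode k h)) *
        (HopfAlgebra.antipode k h' * T.v) := by
  have h1 : HopfAlgebra.antipode k ∘ₗ (leftConv φ).toLinearMap =
      (T.toTwisted.toLinearMap ∘ₗ (T.antipode ∘ₗ LinearMap.mulLeft k h' ∘ₗ
        LinearMap.mulRight k h) ∘ₗ T.toTwisted.symm.toLinearMap) ∘ₗ (rightConv φ).toLinearMap := by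
    refine LinearMap.ext fun b => ?_
    obtain ⟨b, rfl⟩ := T.toTwisted.surjective b
    change T.toTwisted (T.antipode (T.toTwisted.symm _)) = _
    simp only [AlgHom.toLinearMap_apply, hconv]
    simp [mul_assoc]
  have h2 : ∀ (f : A →ₗ[k] A) (z : T.Twisted ⊗[k] T.Twisted),
      T.toTwisted.symm (LinearMap.mul' k T.Twisted ((T.toTwisted.toLinearMap ∘ₗ f ∘ₗ
        T.toTwisted.symm.toLinearMap).lTensor T.Twisted z)) =
      LinearMap.mul' k A (f.lTensor A
        (Algebra.TensorProduct.map T.toTwisted.symm.toAlgHom T.toTwisted.symm.toAlgHom z)) := by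
    intro f z
    induction z with
    | zero => simp
    | add c e hc he => simp only [map_add, hc, he]
    | tmul c d => simp
  have h3 : ∀ b : T.Twisted,
      Algebra.TensorProduct.map T.toTwisted.symm.toAlgHom T.toTwisted.symm.toAlgHom
        (Coalgebra.comul (R := k) b) = T.comul (T.toTwisted.symm b) := by
    intro b
    obtain ⟨b, rfl⟩ := T.toTwisted.surjective b
    rw [comul_toTwisted, AlgEquiv.symm_apply_apply]
    generalize T.comul b = w
    induction w with
    | zero => simp
    | add c e hc he => simp only [map_add, hc, he]
    | tmul c d => simp
  -- Here `J⁻¹ Δ(b) J` acts on `v⁻¹ S(h)`, which `hv` rewrites as `J⁻¹ ▷ S(h)`; the inner `J` and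
  -- `J⁻¹` cancel and only the outer `J⁻¹` remains.
  rw [rid_lTensor_adjointCoaction, h1, LinearMap.lTensor_comp_apply, lTensor_rightConv_comul,
    h2, h3, mul_lTensor_antipode_conj, comul_apply, map_mul (tensorAction k A),
    map_mul (tensorAction k A), ← hv, ← Module.End.mul_apply, mul_assoc _ (tensorAction k A ↑T.J),
    ← map_mul (tensorAction k A) ↑T.J, T.J.mul_inv, map_one, mul_one, Module.End.mul_apply]

theorem tensorAction_inv_injective : Function.Injective (tensorAction k A (↑T.J⁻¹)) := by
  refine Function.LeftInverse.injective (g := tensorAction k A (↑T.J)) fun x => ?_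
  rw [← Module.End.mul_apply, ← map_mul, T.J.mul_inv, map_one, Module.End.one_apply]

/-- A finite-dimensional algebra is Noetherian, so a one-sided inverse is two-sided. -/
theorem v_mul_vInv {k A : Type*} [Field k] [Ring A] [HopfAlgebra k A] [FiniteDimensional k A]
    (T : HopfTwist k A) : T.v * T.vInv = 1 := by
  have : IsNoetherianRing A := isNoetherian_of_tower k inferInstance
  exact mul_eq_one_symm T.vInv_mul_v

end HopfTwist

/-! ### Right convolution against the counit and against quotient maps. -/

namespace HopfAlgebra

variable {k A : Type*} [CommRing k] [Ring A] [HopfAlgebra k A]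

theorem counit_rightConv (φ : A →ₐ[k] k) (a : A) :
    Coalgebra.counit (R := k) (rightConv φ a) = φ a := by
  have h : ∀ z : A ⊗[k] A, Coalgebra.counit (R := k) (Algebra.TensorProduct.rid k k A
      (Algebra.TensorProduct.map (AlgHom.id k A) φ z)) =
      φ (TensorProduct.lid k A ((Coalgebra.counit (R := k) (A := A)).rTensor A z)) := by
    intro z
    induction z with
    | zero => simp
    | add c e hc he => simp only [map_add, hc, he]
    | tmul c d => simp [mul_comm]
  rw [rightConv_apply, h, Coalgebra.rTensor_counit_comul]
  simp

/-- Used to see that right convolution with a character factoring through `π` preserves `ker π`. -/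
theorem map_rightConv {B : Type*} [Ring B] [HopfAlgebra k B] (π : A →ₐc[k] B) (ψ : B →ₐ[k] k)
    (a : A) : π (rightConv (ψ.comp (π : A →ₐ[k] B)) a) = rightConv ψ (π a) := by
  rw [rightConv_apply, rightConv_apply, ← CoalgHomClass.map_comp_comul_apply]
  generalize Coalgebra.comul (R := k) a = z
  induction z with
  | zero => simp
  | add c e hc he => simp only [map_add, hc, he]
  | tmul c d => simp

end HopfAlgebra

/-! ### The alternating bicharacter of a 2-cocycle on an abelian group. -/

namespace NormalizedTwoCocycle

variable {Γ k : Type*} [CommGroup Γ] [Field k] (ω : NormalizedTwoCocycle Γ k)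

theorem isRegular_iff (g : Γ) : ω.IsRegular g ↔ ∀ h, ω.toFun g h = ω.toFun h g :=
  ⟨fun H h => H h (Subgroup.mem_centralizer_singleton_iff.2 (mul_comm _ _)), fun H h _ => H h⟩

theorem isRegular_one : ω.IsRegular 1 := fun h _ => by rw [ω.map_one_left, ω.map_one_right]

/-- The character `h ↦ ω(g, h) / ω(h, g)` of an abelian group. -/
def commutatorChar (g : Γ) : Γ →* kˣ where
  toFun h := ω.toFun g h / ω.toFun h g
  map_one' := by rw [ω.map_one_left, ω.map_one_right, div_one]
  map_mul' a b := by
    have h1 := ω.cocycle g a b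
    have h2 := ω.cocycle a b g
    have h3 := ω.cocycle a g b
    rw [mul_comm g a] at h1
    rw [mul_comm b g] at h2
    rw [div_mul_div_comm, div_eq_div_iff_mul_eq_mul]
    -- These extra factors supply the missing terms of the cocycle identities for `(g, a, b)`, `(a,
    -- b, g)` and `(a, g, b)`.
    refine mul_right_cancel (b := ω.toFun a b * ω.toFun (a * g) b) ?_
    calc _ = (ω.toFun g (a * b) * ω.toFun a b) * (ω.toFun (a * g) b * ω.toFun a g) *
          ω.toFun b g := by ac_rfl
      _ = (ω.toFun (a * g) b * ω.toFun g a) * (ω.toFun a (g * b) * ω.toFun g b) *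
          ω.toFun b g := by rw [← h1, h3]
      _ = (ω.toFun a (g * b) * ω.toFun b g) * (ω.toFun (a * g) b * ω.toFun g a *
          ω.toFun g b) := by ac_rfl
      _ = _ := by rw [← h2]; ac_rfl

theorem commutatorChar_apply (g h : Γ) :
    ω.commutatorChar g h = ω.toFun g h / ω.toFun h g := rfl

end NormalizedTwoCocycle

/-! ### The adjoint action on a group element, and its rank. -/

namespace GroupTwist

open HopfAlgebra

section AdjointAction

variable {k G : Type*} [Field k] [Group G]

/-- The linear map `kG → kG` with `x ↦ x g x⁻¹` for `x ∈ G`. -/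
noncomputable def conjMap (k : Type*) {G : Type*} [Field k] [Group G] (g : G) :
    MonoidAlgebra k G →ₗ[k] MonoidAlgebra k G :=
  (tensorAction k (MonoidAlgebra k G)).toLinearMap.flip (MonoidAlgebra.single g 1) ∘ₗ
    Coalgebra.comul

theorem conjMap_apply (g : G) (a : MonoidAlgebra k G) : conjMap k g a =
    tensorAction k (MonoidAlgebra k G) (Coalgebra.comul (R := k) a) (MonoidAlgebra.single g 1) :=
  rfl

theorem conjMap_single (g x : G) : conjMap k g (MonoidAlgebra.single x 1) =
    MonoidAlgebra.single (x * g * x⁻¹) 1 := by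
  simp [conjMap_apply, MonoidAlgebra.single_mul_single]

theorem conjMap_one (a : MonoidAlgebra k G) :
    conjMap k 1 a = algebraMap k _ (Coalgebra.counit (R := k) a) := by
  rw [conjMap_apply, ← MonoidAlgebra.one_def, tensorAction_one, HopfTwist.rightMul_comul]

/-- The range contains the conjugates of `g`, which are linearly independent. Their number is the
index of the centralizer, a divisor of `|G|` other than 1. -/
theorem le_finrank_range_conjMap [Finite G] {p : ℕ}
    (hp : ∀ q : ℕ, q.Prime → q ∣ Nat.card G → p ≤ q) {g : G} (hg : g ∉ Subgroup.center G) :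
    p ≤ Module.finrank k (LinearMap.range (conjMap k g)) := by
  classical
  set N := (MulAction.stabilizer (ConjAct G) g).index with hN
  have h1 : N ≠ 1 := by
    intro h
    refine hg (Subgroup.mem_center_iff.2 fun x => ?_)
    have hx : ConjAct.toConjAct x ∈ MulAction.stabilizer (ConjAct G) g := by
      rw [Subgroup.index_eq_one.1 h]; trivial
    rw [MulAction.mem_stabilizer_iff, ConjAct.toConjAct_smul, mul_inv_eq_iff_eq_mul] at hx
    exact hx
  have h2 : N ∣ Nat.card G := (Subgroup.index_dvd_card _).trans (dvd_of_eq rfl)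
  have h3 : p ≤ N := (hp _ (Nat.minFac_prime h1) ((Nat.minFac_dvd N).trans h2)).trans
    (Nat.minFac_le (Nat.pos_of_dvd_of_pos h2 Nat.card_pos))
  refine h3.trans ?_
  rw [hN, MulAction.index_stabilizer]
  have : Fintype (MulAction.orbit (ConjAct G) g) := Fintype.ofFinite _
  rw [← Nat.card_coe_set_eq, Nat.card_eq_fintype_card]
  let b : MulAction.orbit (ConjAct G) g → LinearMap.range (conjMap k g) := fun y =>
    ⟨MonoidAlgebra.single y.1 1, by
      obtain ⟨_, x, rfl⟩ := y
      exact ⟨MonoidAlgebra.single (ConjAct.ofConjAct x) 1, conjMap_single _ _⟩⟩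
  refine LinearIndependent.fintype_card_le_finrank (R := k) (b := b) ?_
  refine LinearIndependent.of_comp (LinearMap.range (conjMap k g)).subtype ?_
  exact (MonoidAlgebra.basis G k).linearIndependent.comp _ Subtype.val_injective

/-- Let `r` be a surjective endomorphism of `kG` that preserves the kernel of `f : kG → V`, where
`V` has dimension at most the least prime divisor of `|G|`, and let `g` be non-central. If
`conjMap k g ∘ r` kills the kernel of `f`, then `f` kills the kernel of `conjMap k g`. -/
theorem apply_eq_zero_of_conjMap_eq_zero [Finite G] {p : ℕ}
    (hp : ∀ q : ℕ, q.Prime → q ∣ Nat.card G → p ≤ q) {g : G} (hg : g ∉ Subgroup.center G)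
    {V : Type*} [AddCommGroup V] [Module k V] [FiniteDimensional k V]
    (hV : Module.finrank k V ≤ p) (f : MonoidAlgebra k G →ₗ[k] V)
    (r : MonoidAlgebra k G →ₗ[k] MonoidAlgebra k G) (hr : Function.Surjective r)
    (hfr : ∀ a, f a = 0 → f (r a) = 0) (hf : ∀ a, f a = 0 → conjMap k g (r a) = 0)
    {b : MonoidAlgebra k G} (hb : conjMap k g b = 0) : f b = 0 := by
  have h1 := LinearMap.finrank_range_add_finrank_ker (conjMap k g ∘ₗ r)
  have h2 := LinearMap.finrank_range_add_finrank_ker f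
  have h3 : LinearMap.range (conjMap k g ∘ₗ r) = LinearMap.range (conjMap k g) :=
    LinearMap.range_comp_of_range_eq_top _ (LinearMap.range_eq_top.2 hr)
  have h4 := le_finrank_range_conjMap (k := k) hp hg
  have h5 := Submodule.finrank_le (LinearMap.range f)
  rw [h3] at h1
  -- By rank–nullity, `rank f ≤ p ≤ rank (conjMap k g)` makes the larger kernel no bigger in
  -- dimension than `ker f`.
  have h6 : LinearMap.ker f = LinearMap.ker (conjMap k g ∘ₗ r) :=
    Submodule.eq_of_le_of_finrank_le (fun a ha => hf a ha) (by omega)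
  obtain ⟨a, rfl⟩ := hr b
  refine hfr a ?_
  have : a ∈ LinearMap.ker f := h6 ▸ hb
  exact this

/-- Group algebras are cocommutative. -/
theorem leftConv_eq_rightConv (φ : MonoidAlgebra k G →ₐ[k] k) : leftConv φ = rightConv φ :=
  MonoidAlgebra.algHom_ext (fun x => by simp [leftConv_apply, rightConv_apply])
    (Subsingleton.elim _ _)

/-- Each group element `x` is scaled by `φ(x)`, which is nonzero because `x` is invertible. -/
theorem rightConv_surjective (φ : MonoidAlgebra k G →ₐ[k] k) :
    Function.Surjective (rightConv φ) := by
  intro a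
  induction a using MonoidAlgebra.induction_linear with
  | zero => exact ⟨0, map_zero _⟩
  | add a b ha hb =>
    obtain ⟨a, rfl⟩ := ha
    obtain ⟨b, rfl⟩ := hb
    exact ⟨a + b, map_add _ _ _⟩
  | single x c =>
    have hx : φ (MonoidAlgebra.single x 1) ≠ 0 := by
      intro h
      have := map_mul φ (MonoidAlgebra.single x 1) (MonoidAlgebra.single x⁻¹ 1)
      rw [h, zero_mul, MonoidAlgebra.single_mul_single, mul_inv_cancel, mul_one,
        ← MonoidAlgebra.one_def, map_one] at this
      exact one_ne_zero this
    refine ⟨(c * (φ (MonoidAlgebra.single x 1))⁻¹) • MonoidAlgebra.single x 1, ?_⟩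
    rw [map_smul, rightConv_apply]
    simp [MonoidAlgebra.smul_single, hx]

end AdjointAction

end GroupTwist

/-! ### Convolution in the twisted group algebra, and the role of `h`. -/

namespace GroupTwist

open HopfAlgebra

section TwistedConvolution

attribute [local instance] Fintype.ofFinite

variable {k : Type*} [Field k] [CharZero k] {G : Type*} [Group G] [Finite G]
  (H : Subgroup G)

theorem sum_smul_idem_mul_sum_smul_idem (c d : (H →* kˣ) → kˣ) :
    (∑ β : H →* kˣ, ((c β : kˣ) : k) • idem (G := G) H β) *
      (∑ β : H →* kˣ, ((d β : kˣ) : k) • idem H β) =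
    ∑ β : H →* kˣ, ((c β * d β : kˣ) : k) • idem H β := by
  rw [sum_smul_mul_sum_smul (fun β : H →* kˣ => idem (G := G) H β) (fun β => idem_mul_self H β)
    (fun α β => idem_mul_of_ne H α β)]
  simp only [Units.val_mul]

variable [IsAlgClosed k] [IsMulCommutative H]

theorem idem_mul_single (χ : H →* kˣ) (h : H) :
    idem H χ * MonoidAlgebra.single (h : G) (1 : k) = ((χ h : kˣ) : k) • idem H χ := by
  rw [← sum_smul_idem H h, Finset.mul_sum, Finset.sum_eq_single_of_mem χ (Finset.mem_univ _),
    mul_smul_comm, idem_mul_self]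
  intro ψ _ hψ
  rw [mul_smul_comm, idem_mul_of_ne H _ _ hψ.symm, smul_zero]

/-- From `h e_α = α(h) e_α` one gets `χ(h) φ(e_α) = α(h) φ(e_α)`, so `φ(e_α) ≠ 0` forces `α = χ`;
the values at all `e_α` add up to `φ(1) = 1`. -/
theorem apply_idem (φ : MonoidAlgebra k G →ₐ[k] k) (χ : H →* kˣ)
    (hχ : ∀ h : H, φ (MonoidAlgebra.single (h : G) 1) = χ h) :
    (∀ α : H →* kˣ, α ≠ χ → φ (idem H α) = 0) ∧ φ (idem H χ) = 1 := by
  have h0 : ∀ α : H →* kˣ, α ≠ χ → φ (idem H α) = 0 := by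
    intro α hα
    by_contra hne
    refine hα (MonoidHom.ext fun h => Units.ext ?_)
    have := congrArg φ (single_mul_idem H α h)
    rw [map_mul, map_smul, hχ, smul_eq_mul] at this
    exact (mul_right_cancel₀ hne this).symm
  refine ⟨h0, ?_⟩
  rw [← map_one φ, ← sum_idem H, map_sum,
    Finset.sum_eq_single_of_mem χ (Finset.mem_univ _) fun α _ h => h0 α h]

theorem lid_map_tensorSum (φ : MonoidAlgebra k G →ₐ[k] k) (χ : H →* kˣ)
    (hχ : ∀ h : H, φ (MonoidAlgebra.single (h : G) 1) = χ h)
    (f : (H →* kˣ) → (H →* kˣ) → kˣ) :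
    Algebra.TensorProduct.lid k _ (Algebra.TensorProduct.map φ (AlgHom.id k _) (tensorSum H f)) =
      ∑ β : H →* kˣ, ((f χ β : kˣ) : k) • idem H β := by
  obtain ⟨h0, h1⟩ := apply_idem H φ χ hχ
  simp only [tensorSum, map_sum, map_smul, Algebra.TensorProduct.map_tmul, AlgHom.id_apply,
    Algebra.TensorProduct.lid_tmul]
  rw [Finset.sum_eq_single_of_mem χ (Finset.mem_univ _)]
  · simp [h1]
  · intro α _ hα
    simp [h0 α hα]

theorem rid_map_tensorSum (φ : MonoidAlgebra k G →ₐ[k] k) (χ : H →* kˣ)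
    (hχ : ∀ h : H, φ (MonoidAlgebra.single (h : G) 1) = χ h)
    (f : (H →* kˣ) → (H →* kˣ) → kˣ) :
    Algebra.TensorProduct.rid k k _
      (Algebra.TensorProduct.map (AlgHom.id k _) φ (tensorSum H f)) =
      ∑ β : H →* kˣ, ((f β χ : kˣ) : k) • idem H β := by
  obtain ⟨h0, h1⟩ := apply_idem H φ χ hχ
  simp only [tensorSum, map_sum, map_smul, Algebra.TensorProduct.map_tmul, AlgHom.id_apply,
    Algebra.TensorProduct.rid_tmul]
  refine Finset.sum_congr rfl fun β _ => ?_
  rw [Finset.sum_eq_single_of_mem χ (Finset.mem_univ _)]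
  · simp [h1]
  · intro α _ hα
    simp [h0 α hα]

theorem single_mul_antipode_idem (χ : H →* kˣ) (h : H) :
    MonoidAlgebra.single (h : G) (1 : k) * antipode k (idem H χ) =
      antipode k (idem H χ) * MonoidAlgebra.single (h : G) (1 : k) := by
  have hS : MonoidAlgebra.single (h : G) (1 : k) =
      antipode k (MonoidAlgebra.single ((h⁻¹ : H) : G) (1 : k)) := by simp
  rw [hS, ← antipode_mul_antidistrib, ← antipode_mul_antidistrib, idem_mul_single,
    single_mul_idem]

/-- Elements of `H` commute with every `S(e_β)`. Applied to `J⁻¹`, whose action on 1 gives `v⁻¹`,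
this is the hypothesis `hv` of `rid_lTensor_adjointCoaction_toTwisted`. -/
theorem tensorAction_tensorSum_single (f : (H →* kˣ) → (H →* kˣ) → kˣ) (h : H) :
    tensorAction k (MonoidAlgebra k G) (tensorSum H f) (MonoidAlgebra.single (h : G) 1) =
      tensorAction k (MonoidAlgebra k G) (tensorSum H f) 1 * MonoidAlgebra.single (h : G) 1 := by
  simp only [tensorSum, map_sum, map_smul, LinearMap.sum_apply, LinearMap.smul_apply,
    tensorAction_tmul, mul_one, Finset.sum_mul, smul_mul_assoc, mul_assoc,
    single_mul_antipode_idem]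

/-- Duality for finite abelian groups; `η` will be the commutator character of `χ`. -/
theorem exists_eval_eq (η : (H →* kˣ) →* kˣ) : ∃ h : H, ∀ β : H →* kˣ, β h = η β := by
  open scoped IsMulCommutative in
  have : NeZero (Monoid.exponent H : k) :=
    ⟨Nat.cast_ne_zero.mpr Monoid.exponent_ne_zero_of_finite⟩
  exact ⟨CommGroup.monoidHomMonoidHomEquiv H k η,
    fun β => CommGroup.apply_monoidHomMonoidHomEquiv k β η⟩

variable (ω : NormalizedTwoCocycle (H →* kˣ) k)

theorem twist_J : ((twist H ω).J : MonoidAlgebra k G ⊗[k] MonoidAlgebra k G) =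
    tensorSum H ω.toFun := rfl

theorem twist_J_inv : (((twist H ω).J⁻¹ : (MonoidAlgebra k G ⊗[k] MonoidAlgebra k G)ˣ) :
    MonoidAlgebra k G ⊗[k] MonoidAlgebra k G) = tensorSum H fun α β => (ω.toFun α β)⁻¹ := rfl

variable (φ : (twist H ω).Twisted →ₐ[k] k) (χ : H →* kˣ)

/-- Applying the character to the first leg of `J⁻¹ Δ(a) J` keeps only the terms of `J` and `J⁻¹`
with first index `χ`; the untwisted left convolution in the middle may be replaced by the right one.
-/
theorem toTwisted_leftConv (a : MonoidAlgebra k G)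
    (hχ : ∀ h : H, φ ((twist H ω).toTwisted (MonoidAlgebra.single (h : G) 1)) = χ h) :
    (twist H ω).toTwisted.symm (leftConv φ ((twist H ω).toTwisted a)) =
      (∑ β : H →* kˣ, (((ω.toFun χ β)⁻¹ : kˣ) : k) • idem H β) *
        rightConv (φ.comp (twist H ω).toTwisted.toAlgHom) a *
        (∑ β : H →* kˣ, ((ω.toFun χ β : kˣ) : k) • idem H β) := by
  rw [HopfTwist.leftConv_toTwisted, HopfTwist.comul_apply]
  simp only [map_mul]
  rw [twist_J, twist_J_inv, lid_map_tensorSum H (φ.comp (twist H ω).toTwisted.toAlgHom) χ hχ,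
    lid_map_tensorSum H (φ.comp (twist H ω).toTwisted.toAlgHom) χ hχ,
    ← leftConv_apply, leftConv_eq_rightConv]

theorem toTwisted_rightConv (a : MonoidAlgebra k G)
    (hχ : ∀ h : H, φ ((twist H ω).toTwisted (MonoidAlgebra.single (h : G) 1)) = χ h) :
    (twist H ω).toTwisted.symm (rightConv φ ((twist H ω).toTwisted a)) =
      (∑ β : H →* kˣ, (((ω.toFun β χ)⁻¹ : kˣ) : k) • idem H β) *
        rightConv (φ.comp (twist H ω).toTwisted.toAlgHom) a *
        (∑ β : H →* kˣ, ((ω.toFun β χ : kˣ) : k) • idem H β) := by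
  rw [HopfTwist.rightConv_toTwisted, HopfTwist.comul_apply]
  simp only [map_mul]
  rw [twist_J, twist_J_inv, rid_map_tensorSum H (φ.comp (twist H ω).toTwisted.toAlgHom) χ hχ,
    rid_map_tensorSum H (φ.comp (twist H ω).toTwisted.toAlgHom) χ hχ,
    ← rightConv_apply]

theorem toTwisted_rightConv_surjective
    (hχ : ∀ h : H, φ ((twist H ω).toTwisted (MonoidAlgebra.single (h : G) 1)) = χ h) :
    Function.Surjective fun a : MonoidAlgebra k G =>
      (twist H ω).toTwisted.symm (rightConv φ ((twist H ω).toTwisted a)) := by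
  intro b
  obtain ⟨a, ha⟩ := rightConv_surjective (φ.comp (twist H ω).toTwisted.toAlgHom)
    ((∑ β : H →* kˣ, ((ω.toFun β χ : kˣ) : k) • idem H β) * b *
      (∑ β : H →* kˣ, (((ω.toFun β χ)⁻¹ : kˣ) : k) • idem H β))
  refine ⟨a, ?_⟩
  have h1 : (∑ β : H →* kˣ, (((ω.toFun β χ)⁻¹ : kˣ) : k) • idem (G := G) H β) *
      (∑ β : H →* kˣ, ((ω.toFun β χ : kˣ) : k) • idem H β) = 1 := by
    rw [sum_smul_idem_mul_sum_smul_idem]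
    simp only [inv_mul_cancel, Units.val_one, one_smul, sum_idem]
  simp only [toTwisted_rightConv H ω φ χ a hχ, ha]
  rw [← mul_assoc, ← mul_assoc, h1, one_mul, mul_assoc, h1, mul_one]

/-- The expansion `h = ∑ β(h) e_β` has coefficients `ω(χ, β) / ω(β, χ)`, exactly the quotient of the
elements that conjugate in the two convolution formulas. -/
theorem toTwisted_leftConv_eq_conj {h : H} (hh : ∀ β : H →* kˣ, β h = ω.commutatorChar χ β)
    (hχ : ∀ h : H, φ ((twist H ω).toTwisted (MonoidAlgebra.single (h : G) 1)) = χ h)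
    (a : MonoidAlgebra k G) :
    (twist H ω).toTwisted.symm (leftConv φ ((twist H ω).toTwisted a)) =
      MonoidAlgebra.single ((h⁻¹ : H) : G) 1 *
        (twist H ω).toTwisted.symm (rightConv φ ((twist H ω).toTwisted a)) *
        MonoidAlgebra.single (h : G) 1 := by
  have h1 : MonoidAlgebra.single ((h⁻¹ : H) : G) (1 : k) *
      (∑ β : H →* kˣ, (((ω.toFun β χ)⁻¹ : kˣ) : k) • idem H β) =
      ∑ β : H →* kˣ, (((ω.toFun χ β)⁻¹ : kˣ) : k) • idem H β := by
    rw [← sum_smul_idem H h⁻¹, sum_smul_idem_mul_sum_smul_idem]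
    refine Finset.sum_congr rfl fun β _ => ?_
    rw [map_inv, hh, NormalizedTwoCocycle.commutatorChar_apply, inv_div, div_mul_eq_mul_div,
      mul_inv_cancel, one_div]
  have h2 : (∑ β : H →* kˣ, ((ω.toFun β χ : kˣ) : k) • idem H β) *
      MonoidAlgebra.single (h : G) (1 : k) =
      ∑ β : H →* kˣ, ((ω.toFun χ β : kˣ) : k) • idem H β := by
    rw [← sum_smul_idem H h, sum_smul_idem_mul_sum_smul_idem]
    refine Finset.sum_congr rfl fun β _ => ?_
    rw [hh, NormalizedTwoCocycle.commutatorChar_apply, mul_div_cancel]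
  rw [toTwisted_leftConv H ω φ χ a hχ, toTwisted_rightConv H ω φ χ a hχ, ← mul_assoc, ← mul_assoc,
    h1, mul_assoc _ _ (MonoidAlgebra.single (h : G) 1), h2]

theorem rid_lTensor_adjointCoaction_eq_zero_iff {h : H}
    (hh : ∀ β : H →* kˣ, β h = ω.commutatorChar χ β)
    (hχ : ∀ h : H, φ ((twist H ω).toTwisted (MonoidAlgebra.single (h : G) 1)) = χ h)
    (a : MonoidAlgebra k G) :
    TensorProduct.rid k _ (φ.toLinearMap.lTensor _
      (adjointCoaction k (twist H ω).Twisted ((twist H ω).toTwisted a))) = 0 ↔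
    conjMap k (h : G)⁻¹ ((twist H ω).toTwisted.symm
      (rightConv φ ((twist H ω).toTwisted a))) = 0 := by
  have hS : antipode k (MonoidAlgebra.single (h : G) (1 : k)) =
      MonoidAlgebra.single ((h⁻¹ : H) : G) (1 : k) := by simp
  have key := (twist H ω).rid_lTensor_adjointCoaction_toTwisted φ _ _
    (toTwisted_leftConv_eq_conj H ω φ χ hh hχ) (by
      rw [hS, twist_J_inv, tensorAction_tensorSum_single, tensorAction_one]
      rfl) a
  rw [hS, InvMemClass.coe_inv, ← conjMap_apply] at key
  rw [← map_eq_zero_iff _ (twist H ω).toTwisted.symm.injective, key]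
  set c := conjMap k (h : G)⁻¹ ((twist H ω).toTwisted.symm
    (rightConv φ ((twist H ω).toTwisted a)))
  -- The right-hand factor in `key` is invertible, so it does not affect vanishing; nor does the
  -- action of `J⁻¹`.
  have hu : antipode k (MonoidAlgebra.single (h : G)⁻¹ (1 : k)) * (twist H ω).v *
      ((twist H ω).vInv * MonoidAlgebra.single (h : G)⁻¹ 1) = 1 := by
    rw [mul_assoc, ← mul_assoc (twist H ω).v, HopfTwist.v_mul_vInv, one_mul,
      MonoidAlgebra.antipode_single]
    simp [MonoidAlgebra.single_mul_single, MonoidAlgebra.one_def]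
  constructor
  · intro h0
    have := congrArg (· * ((twist H ω).vInv * MonoidAlgebra.single (h : G)⁻¹ (1 : k))) h0
    simp only [mul_assoc] at this hu
    rw [hu, mul_one, zero_mul] at this
    exact (twist H ω).tensorAction_inv_injective (this.trans (map_zero _).symm)
  · intro h0
    rw [h0, map_zero, zero_mul]

end TwistedConvolution

end GroupTwist

/-! ### Reduction to single characters, and the normality criterion. -/

namespace GroupTwist

open HopfAlgebra

section Separation

attribute [local instance] Fintype.ofFinite

variable {k : Type*} [Field k] [IsAlgClosed k] [CharZero k] {F : Type*} [Group F] [Finite F]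
  [IsMulCommutative (⊤ : Subgroup F)]

/-- The characters of a finite abelian group `F` separate the elements of `A ⊗ kF`. -/
theorem eq_zero_of_lTensor_lift_eq_zero {A : Type*} [AddCommGroup A] [Module k A]
    (z : A ⊗[k] MonoidAlgebra k F)
    (hz : ∀ μ : F →* kˣ,
      (MonoidAlgebra.lift k k F ((Units.coeHom k).comp μ)).toLinearMap.lTensor A z = 0) :
    z = 0 := by
  let μ : ((⊤ : Subgroup F) →* kˣ) → F →* kˣ := fun χ =>
    χ.comp Subgroup.topEquiv.symm.toMonoidHom
  -- Fourier inversion `x = ∑ χ(x) e_χ` on `F`, viewed as the subgroup `⊤` of itself.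
  have hid : (LinearMap.id : MonoidAlgebra k F →ₗ[k] MonoidAlgebra k F) =
      ∑ χ : (⊤ : Subgroup F) →* kˣ, LinearMap.toSpanSingleton k _ (idem ⊤ χ) ∘ₗ
        (MonoidAlgebra.lift k k F ((Units.coeHom k).comp (μ χ))).toLinearMap := by
    refine (MonoidAlgebra.basis F k).ext fun x => ?_
    have := sum_smul_idem (k := k) (⊤ : Subgroup F) ⟨x, trivial⟩
    simp only [LinearMap.sum_apply, LinearMap.comp_apply, LinearMap.toSpanSingleton_apply,
      MonoidAlgebra.basis_apply, AlgHom.toLinearMap_apply, MonoidAlgebra.lift_single, one_smul,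
      LinearMap.id_apply]
    exact this.symm
  have h1 : z = (LinearMap.id : MonoidAlgebra k F →ₗ[k] MonoidAlgebra k F).lTensor A z := by simp
  rw [h1, hid, ← LinearMap.coe_lTensorHom, map_sum, LinearMap.sum_apply]
  refine Finset.sum_eq_zero fun χ _ => ?_
  rw [LinearMap.coe_lTensorHom, LinearMap.lTensor_comp_apply, hz, map_zero]

theorem isNormalQuotient_iff {A : Type*} [Ring A] [HopfAlgebra k A]
    (π : A →ₐc[k] MonoidAlgebra k F) :
    IsNormalQuotient π ↔ ∀ (μ : F →* kˣ) (a : A), π a = 0 →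
      TensorProduct.rid k A (((MonoidAlgebra.lift k k F ((Units.coeHom k).comp μ)).comp
        (π : A →ₐ[k] MonoidAlgebra k F)).toLinearMap.lTensor A (adjointCoaction k A a)) = 0 := by
  have hcomp : ∀ (μ : F →* kˣ) (z : A ⊗[k] A),
      ((MonoidAlgebra.lift k k F ((Units.coeHom k).comp μ)).comp
        (π : A →ₐ[k] MonoidAlgebra k F)).toLinearMap.lTensor A z =
      (MonoidAlgebra.lift k k F ((Units.coeHom k).comp μ)).toLinearMap.lTensor A
        (((π : A →ₗc[k] MonoidAlgebra k F) : A →ₗ[k] MonoidAlgebra k F).lTensor A z) := by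
    intro μ z
    rw [← LinearMap.lTensor_comp_apply]
    rfl
  constructor
  · intro h μ a ha
    rw [hcomp, h a ha, map_zero, map_zero]
  · intro h a ha
    refine eq_zero_of_lTensor_lift_eq_zero _ fun μ => ?_
    have := h μ a ha
    rwa [LinearEquiv.map_eq_zero_iff, hcomp] at this

end Separation

variable {k : Type*} [Field k] [IsAlgClosed k] [CharZero k] {G : Type*} [Group G] [Finite G]

/-- The order of `F` enters only through the rank count, so the bound `|F| ≤ p` suffices. -/
theorem isNormalQuotient_iff_isRegular (hZ : Subgroup.center G = ⊥)
    (H : Subgroup G) [IsMulCommutative H] (ω : NormalizedTwoCocycle (H →* kˣ) k)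
    {p : ℕ} (hp : ∀ q : ℕ, q.Prime → q ∣ Nat.card G → p ≤ q)
    {F : Type*} [Group F] [Finite F] [IsMulCommutative (⊤ : Subgroup F)] (hF : Nat.card F ≤ p)
    (π : (twist H ω).Twisted →ₐc[k] MonoidAlgebra k F) :
    IsNormalQuotient π ↔ ∀ μ : F →* kˣ, ω.IsRegular ((pullbackChar π μ).comp H.subtype) := by
  rw [isNormalQuotient_iff]
  -- The equivalence holds for each `μ` separately.
  refine forall_congr' fun μ => ?_
  set ψ := MonoidAlgebra.lift k k F ((Units.coeHom k).comp μ)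
  set φ := ψ.comp (π : (twist H ω).Twisted →ₐ[k] MonoidAlgebra k F)
  set χ := (pullbackChar π μ).comp H.subtype
  have hχ : ∀ h : H, φ ((twist H ω).toTwisted (MonoidAlgebra.single (h : G) 1)) = χ h :=
    fun _ => rfl
  obtain ⟨h, hh⟩ := exists_eval_eq H (ω.commutatorChar χ)
  have hkey := rid_lTensor_adjointCoaction_eq_zero_iff H ω φ χ hh hχ
  constructor
  · intro hn
    by_cases hc : (h : G)⁻¹ ∈ Subgroup.center G
    · rw [hZ, Subgroup.mem_bot, inv_eq_one, OneMemClass.coe_eq_one] at hc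
      rw [NormalizedTwoCocycle.isRegular_iff]
      intro β
      have := hh β
      rw [hc, map_one, NormalizedTwoCocycle.commutatorChar_apply] at this
      exact div_eq_one.1 this.symm
    · have h1 : χ = 1 := by
        refine MonoidHom.ext fun z => Units.ext ?_
        -- `z` and `h` both lie in the abelian group `H`, so conjugation by `z` fixes `h⁻¹`, as
        -- conjugation by 1 does.
        have hz : conjMap k (h : G)⁻¹ (MonoidAlgebra.single (z : G) 1 - 1) = 0 := by
          rw [MonoidAlgebra.one_def, map_sub, conjMap_single, conjMap_single, sub_eq_zero]
          have hzh : (z : G) * (h : G)⁻¹ = (h : G)⁻¹ * z :=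
            congrArg Subtype.val (mul_comm' z h⁻¹)
          rw [hzh, mul_inv_cancel_right, one_mul, inv_one, mul_one]
        have := apply_eq_zero_of_conjMap_eq_zero hp hc
          (by rw [Module.finrank_eq_nat_card_basis (MonoidAlgebra.basis F k)]; exact hF)
          ((π : (twist H ω).Twisted →ₐ[k] MonoidAlgebra k F).toLinearMap ∘ₗ
            (twist H ω).toTwisted.toLinearMap)
          ((twist H ω).toTwisted.symm.toLinearMap ∘ₗ (rightConv φ).toLinearMap ∘ₗ
            (twist H ω).toTwisted.toLinearMap)
          (toTwisted_rightConv_surjective H ω φ χ hχ)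
          (fun a ha => by
            have ha' : π ((twist H ω).toTwisted a) = 0 := ha
            have := map_rightConv π ψ ((twist H ω).toTwisted a)
            rw [ha', map_zero] at this
            exact this)
          (fun a ha => (hkey a).1 (hn _ ha)) hz
        have h2 := congrArg ψ this
        rw [map_zero] at h2
        change φ ((twist H ω).toTwisted (MonoidAlgebra.single (z : G) 1 - 1)) = 0 at h2
        rw [map_sub, map_sub, hχ, map_one, map_one, sub_eq_zero] at h2
        exact h2
      rw [h1]
      exact ω.isRegular_one
  · intro hr a ha
    have h1 : h = 1 := by
      have hone : ω.commutatorChar χ = 1 := MonoidHom.ext fun β => by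
        rw [NormalizedTwoCocycle.commutatorChar_apply, (ω.isRegular_iff χ).1 hr β, div_self']
        rfl
      open scoped IsMulCommutative in
      have : NeZero (Monoid.exponent H : k) :=
        ⟨Nat.cast_ne_zero.mpr Monoid.exponent_ne_zero_of_finite⟩
      -- Characters separate the points of `H`, and regularity of `χ` says that each of them is
      -- trivial at `h`.
      exact (CommGroup.forall_apply_eq_apply_iff H (M := k)).1 fun β => by
        rw [hh, hone, map_one, MonoidHom.one_apply]
    refine (hkey a).2 ?_
    have ha' : φ ((twist H ω).toTwisted a) = 0 := (congrArg ψ ha).trans (map_zero ψ)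
    -- For `h = 1` the adjoint action is the counit, whose value on the right convolution of `a` is
    -- `φ(a) = 0`.
    rw [h1, OneMemClass.coe_one, inv_one, conjMap_one, ← HopfTwist.counit_toTwisted,
      AlgEquiv.apply_symm_apply, counit_rightConv, ha', map_zero]

end GroupTwist

theorem mainTheorem8 {k : Type*} [Field k] [IsAlgClosed k] [CharZero k]
    {G : Type*} [Group G] [Finite G] (hZ : Subgroup.center G = ⊥)
    (H : Subgroup G) [IsMulCommutative H] (ω : NormalizedTwoCocycle (H →* kˣ) k)
    {p : ℕ} (hp : IsLeast {q : ℕ | q.Prime ∧ q ∣ Nat.card G} p)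
    {F : Type*} [Group F] (hF : Nonempty (F ≃* Multiplicative (ZMod p)))
    (π : (GroupTwist.twist H ω).Twisted →ₐc[k] MonoidAlgebra k F)
    (hπ : Function.Surjective π) :
    (IsNormalQuotient π ↔
      ∀ μ : F →* kˣ, ω.IsRegular ((GroupTwist.pullbackChar π μ).comp H.subtype)) ∧
    (ω.IsNondegenerate →
      (IsNormalQuotient π ↔
        ∀ μ : F →* kˣ, (GroupTwist.pullbackChar π μ).comp H.subtype = 1)) := by
  obtain ⟨e⟩ := hF
  have : NeZero p := ⟨hp.1.1.ne_zero⟩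
  have : Finite F := Finite.of_equiv _ e.symm.toEquiv
  have : IsMulCommutative (⊤ : Subgroup F) :=
    ⟨⟨fun a b => Subtype.ext (e.injective (by
      simp only [Subgroup.coe_mul, map_mul, mul_comm]))⟩⟩
  have hcard : Nat.card F ≤ p := by
    rw [Nat.card_congr e.toEquiv, Nat.card_congr Multiplicative.toAdd, Nat.card_zmod]
  have key := GroupTwist.isNormalQuotient_iff_isRegular hZ H ω
    (fun q hq hd => hp.2 ⟨hq, hd⟩) hcard π
  refine ⟨key, fun hω => key.trans (forall_congr' fun μ => ⟨fun h => hω _ h, fun h => ?_⟩)⟩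
  rw [h]
  exact ω.isRegular_one
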